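/- Let $n\ge 1$. For $a=(a_n,\dots,a_1)\in\mathbb R^n$ and $b=(b_{n-1},\dots,b_1)\in(0,\infty)^{n-1}$ let $T=T(a,b)$ be the real symmetric tridiagonal $n\times n$ matrix with diagonal $a$ and sub-diagonal $b$. Let $T=Q\Lambda Q^{T}$ be its eigendecomposition, with $Q$ orthogonal, $\Lambda=\mathrm{diag}(\lambda_1,\dots,\lambda_n)$, $\lambda_1\le\dots\le\lambda_n$, and the signs of the columns of $Q$ chosen such that the first row $q=(q_1,\dots,q_n)$ of $Q$ is non-negative. Let $S^{n-1}_+$ be the set of unit vectors $q\in\mathbb R^n$ all of whose entries are positive. Then $q$ and $\lambda$ are uniquely determined by $T$, and $T\mapsto(q,\lambda)$ is a bijection from the set of all such matrices $T$ (all $a\in\mathbb R^n$, $b\in(0,\infty)^{n-1}$) onto $S^{n-1}_+\times\{\lambda\in\mathbb R^n:\lambda_1<\dots<\lambda_n\}$. The inverse map $(q,\lambda)\mapsto(a,b)$ is differentiable on this manifold, and the absolute value $J$ of its Jacobian determinant $\partial(a,b)/\partial(q,\lambda)$, taken with respect to orthonormal coordinates on the tangent space $q^\perp$ of the unit sphere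 at $q$ and to the standard coordinates for $\lambda$, $a$ and $b$, is $$J=\frac{\prod_{i=1}^{n-1}b_i}{\prod_{i=1}^{n}q_i}$$ at every point. Moreover $da\,db=J\,dq\,d\lambda$, where $dq$ is the surface measure on $S^{n-1}$ and $da$, $db$, $d\lambda$ are Lebesgue measures; that is, for every measurable $f:\mathbb R^n\times\mathbb R^{n-1}\to[0,\infty]$, $$\int_{\mathbb R^n\times(0,\infty)^{n-1}} f(a,b)\,da\,db=\int_{S^{n-1}_+}\int_{\lambda_1<\dots<\lambda_n} f\big(a(q,\lambda),b(q,\lambda)\big)\,\frac{\prod_{i=1}^{n-1}b_i(q,\lambda)}{\prod_{i=1}^{n}q_i}\,d\lambda\,dq .$$ -/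

import Mathlib

open MeasureTheory

noncomputable section

/-- Parameters `(a, b)` of a symmetric tridiagonal matrix of size `n = m + 1`: the diagonal `a` and
the sub-diagonal `b`, both listed from the upper left to the lower right corner. -/
abbrev TridiagParam (m : ℕ) : Type := (Fin (m + 1) → ℝ) × (Fin m → ℝ)

/-- Pairs `(q, lam)` of a vector `q` of the Euclidean space of dimension `n = m + 1` and a sequence
`lam` of `n` real numbers. -/
abbrev SpectralParam (m : ℕ) : Type := EuclideanSpace ℝ (Fin (m + 1)) × (Fin (m + 1) → ℝ)

/-- The symmetric tridiagonal matrix with diagonal `x.1` and sub-diagonal (and super-diagonal)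
`x.2`. -/
def tridiag {m : ℕ} (x : TridiagParam m) : Matrix (Fin (m + 1)) (Fin (m + 1)) ℝ :=
  Matrix.diagonal x.1 +
    ∑ k : Fin m, (Matrix.single k.succ k.castSucc (x.2 k) + Matrix.single k.castSucc k.succ (x.2 k))

/-- The parameters of the symmetric tridiagonal matrices with positive sub-diagonal. -/
def positiveTridiag (m : ℕ) : Set (TridiagParam m) := {x | ∀ k, 0 < x.2 k}

/-- Pairs `(q, lam)` with `q` of unit Euclidean norm with positive entries and `lam` strictly
increasing. -/
def spectralDomain (m : ℕ) : Set (SpectralParam m) :=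
  {y | ‖y.1‖ = 1 ∧ (∀ i, 0 < y.1 i) ∧ StrictMono y.2}

/-- `tridiag x = Q Λ Qᵀ` is an eigendecomposition with `Q` orthogonal, the eigenvalues
`y.2` on the diagonal of `Λ` in increasing order, and the first row of `Q`
non-negative and equal to `y.1`. -/
def IsSpectralData {m : ℕ} (x : TridiagParam m) (y : SpectralParam m) : Prop :=
  Monotone y.2 ∧ (∀ i, 0 ≤ y.1 i) ∧
    ∃ Q ∈ Matrix.orthogonalGroup (Fin (m + 1)) ℝ,
      tridiag x = Q * Matrix.diagonal y.2 * Q.transpose ∧ ∀ i, Q 0 i = y.1 i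

/-- The map `T ↦ (q, lam)`: eigenvalues and first row of the eigenvector matrix. -/
def spectralMap {m : ℕ} (x : TridiagParam m) : SpectralParam m :=
  Classical.epsilon (IsSpectralData x)

/-- The inverse map `(q, lam) ↦ (a, b)` of the restriction of `spectralMap` to the matrices with
positive sub-diagonal. -/
def inverseSpectralMap {m : ℕ} : SpectralParam m → TridiagParam m :=
  Function.invFunOn spectralMap (positiveTridiag m)

/-- The matrix of partial derivatives `∂(a, b) / ∂(lam, q)` that a linear map `f'` gives,
where `q` varies in the directions `u 0, …, u (m - 1)`. The rows are indexed by the entries of `a`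
and then of `b`, the columns by the entries of `lam` and then by the vectors of `u`. -/
def jacobianMatrix {m : ℕ} (f' : SpectralParam m →L[ℝ] TridiagParam m)
    (u : Fin m → EuclideanSpace ℝ (Fin (m + 1))) :
    Matrix (Fin (m + 1) ⊕ Fin m) (Fin (m + 1) ⊕ Fin m) ℝ :=
  Matrix.of fun r c =>
    let v : SpectralParam m := Sum.elim (fun j => (0, Pi.single j 1)) (fun k => (u k, 0)) c
    Sum.elim (f' v).1 (f' v).2 r

/-- `G` is differentiable at the point `y` of the manifold `spectralDomain m` (an open piece of
the product of the unit sphere and the space of the sequences `lam`), and the absolute value of its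
Jacobian determinant `∂(a, b) / ∂(q, lam)` there, with respect to orthonormal coordinates on the
tangent space of the sphere and the standard coordinates of `lam`, `a` and `b`, is `J`.
(A derivative within `spectralDomain m` is unique on the tangent space of this manifold, which is
the product of the orthogonal complement of `y.1` and the space of the `lam`; the matrix uses
no other value of it.) -/
def HasJacobianAt {m : ℕ} (G : SpectralParam m → TridiagParam m) (y : SpectralParam m) (J : ℝ) :
    Prop :=
  ∃ f' : SpectralParam m →L[ℝ] TridiagParam m,
    HasFDerivWithinAt G f' (spectralDomain m) y ∧
      ∀ u : Fin m → EuclideanSpace ℝ (Fin (m + 1)),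
        Orthonormal ℝ u → (∀ k, inner ℝ y.1 (u k) = 0) → |(jacobianMatrix f' u).det| = J

/-- The measure `dq dlam` on the product of the unit sphere and the space of the `lam`, with `dq`
the surface measure of the unit sphere and `dlam` Lebesgue measure. -/
def surfaceProd (m : ℕ) :
    Measure (Metric.sphere (0 : EuclideanSpace ℝ (Fin (m + 1))) 1 × (Fin (m + 1) → ℝ)) :=
  (volume : Measure (EuclideanSpace ℝ (Fin (m + 1)))).toSphere.prod volume

end

section

variable {m : ℕ}

open Matrix Finset InnerProductSpace Filter Topology

/-! Both sets of coordinates are compared through moments. Write n = m + 1, attach to T an auxiliary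
radius r > 0, and replace the unit vector q by a vector of norm r. The eigendecomposition then says
r² (T^e)₀₀ = ∑ q_i² λ_i^e. The first 2n of these moments serve as common coordinates.

On the matrix side, set z = (r, b). In the order z₀, a₀, z₁, a₁, … each new moment involves one new
parameter, so this moment map is injective for z > 0 and its Jacobian is triangular
(`tridiagMoment_even_sub`, `tridiagMoment_odd_sub`, `det_fderiv_tridiagMomentMap`). With P = ∏_i
z₀⋯z_i its determinant is 2^n P⁴ / ∏ z_i. On the spectral side, the Jacobian is a confluent
Vandermonde matrix with scaled columns, of absolute determinant 2^n (∏ q_i)³ V⁴, where V is the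
Vandermonde determinant of λ (`abs_det_fderiv_spectralMomentMap`). The Gram matrix of the Krylov
vectors, computed on both sides, gives P² = (∏ q_i)² V² (`prod_prod_sq_eq`). Hence (q, λ) ↦ ((‖q‖,
b), a) has Jacobian ∏ z_i / ∏ q_i = ‖q‖ ∏ b_i / ∏ q_i.

Injectivity of T ↦ (q, λ) follows from the moments. Surjectivity is the Lanczos construction: Λ
written in the Gram–Schmidt basis of q, Λq, Λ²q, … is tridiagonal with positive sub-diagonal and
first basis vector q (`exists_tridiag_of_mem_spectralDomain`).

The sphere is reached by splitting off the radial direction. For the determinant, the row of d‖q‖ is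
(1, 0, …, 0) in an orthonormal frame beginning with q (`hasJacobianAt_inverseSpectralMap`). For the
integral, the open-set change of variables is applied on ‖q‖ < 1, and in polar coordinates the
radial factor integrates to 1 (`lintegral_fst_coneIntegrand`). -/

/-! ### Entries of a tridiagonal matrix. -/

lemma tridiag_apply (x : TridiagParam m) (i j : Fin (m + 1)) :
    tridiag x i j = (if i = j then x.1 i else 0) +
      ∑ k : Fin m, ((if k.succ = i ∧ k.castSucc = j then x.2 k else 0) +
        (if k.castSucc = i ∧ k.succ = j then x.2 k else 0)) := by
  simp only [tridiag, Matrix.add_apply, Matrix.diagonal_apply, Matrix.sum_apply,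
    Matrix.single_apply]

lemma tridiag_apply_self (x : TridiagParam m) (i : Fin (m + 1)) : tridiag x i i = x.1 i := by
  rw [tridiag_apply, Finset.sum_eq_zero]
  · simp
  · intro k _
    have h : k.castSucc ≠ k.succ := Fin.castSucc_lt_succ.ne
    rw [if_neg, if_neg, add_zero]
    · rintro ⟨h1, h2⟩; exact h (h1.trans h2.symm)
    · rintro ⟨h1, h2⟩; exact h (h2.trans h1.symm)

lemma tridiag_transpose (x : TridiagParam m) : (tridiag x).transpose = tridiag x := by
  ext i j
  rw [transpose_apply, tridiag_apply, tridiag_apply]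
  congr 1
  · by_cases h : i = j
    · simp [h]
    · simp [h, Ne.symm h]
  · refine Finset.sum_congr rfl fun k _ => ?_
    rw [add_comm]
    simp only [and_comm]

lemma tridiag_comm (x : TridiagParam m) (i j : Fin (m + 1)) : tridiag x i j = tridiag x j i := by
  conv_lhs => rw [← tridiag_transpose x]
  rfl

lemma tridiag_succ_castSucc (x : TridiagParam m) (k : Fin m) :
    tridiag x k.succ k.castSucc = x.2 k := by
  have h : ∀ l : Fin m, l.castSucc ≠ l.succ := fun l => Fin.castSucc_lt_succ.ne
  rw [tridiag_apply, if_neg (h k).symm, zero_add, Finset.sum_eq_single k]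
  · rw [if_pos ⟨rfl, rfl⟩, if_neg (fun e => h k e.1), add_zero]
  · intro l _ hl
    rw [if_neg, if_neg, add_zero]
    · rintro ⟨h1, h2⟩
      simp only [Fin.ext_iff, Fin.val_castSucc, Fin.val_succ] at h1 h2
      omega
    · rintro ⟨h1, h2⟩; exact hl (Fin.succ_injective _ h1)
  · simp

lemma tridiag_castSucc_succ (x : TridiagParam m) (k : Fin m) :
    tridiag x k.castSucc k.succ = x.2 k := by
  rw [tridiag_comm, tridiag_succ_castSucc]

lemma tridiag_eq_zero (x : TridiagParam m) {i j : Fin (m + 1)} (h : (j : ℕ) + 1 < i) :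
    tridiag x i j = 0 := by
  rw [tridiag_apply, if_neg (by rintro rfl; omega), zero_add]
  refine Finset.sum_eq_zero fun k _ => ?_
  rw [if_neg, if_neg, add_zero] <;>
  · rintro ⟨rfl, rfl⟩
    simp only [Fin.val_castSucc, Fin.val_succ] at h
    omega

lemma tridiag_eq_zero' (x : TridiagParam m) {i j : Fin (m + 1)} (h : (i : ℕ) + 1 < j) :
    tridiag x i j = 0 := by
  rw [tridiag_comm, tridiag_eq_zero x h]

/-! ### Existence and uniqueness of the spectral data. -/

/-- An eigenvector of a tridiagonal matrix with nonzero sub-diagonal is determined by its first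
entry. -/
lemma eigenvector_eq_zero {x : TridiagParam m} (hx : x ∈ positiveTridiag m) {μ : ℝ}
    {v : Fin (m + 1) → ℝ} (hv : tridiag x *ᵥ v = μ • v) (h0 : v 0 = 0) : v = 0 := by
  have key : ∀ k : ℕ, ∀ i : Fin (m + 1), (i : ℕ) ≤ k → v i = 0 := by
    intro k
    induction k with
    | zero => intro i hi; rwa [show i = 0 from Fin.ext (by simpa using hi)]
    | succ k ih =>
      intro i hi
      rcases Nat.lt_or_ge i (k + 1) with h | h
      · exact ih i (by omega)
      have hk : k < m := by omega
      have e : i = (⟨k, hk⟩ : Fin m).succ := Fin.ext (by simp; omega)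
      have h1 := congrFun hv (⟨k, hk⟩ : Fin m).castSucc
      rw [Matrix.mulVec, dotProduct, Finset.sum_eq_single i] at h1
      · rw [e, tridiag_castSucc_succ, Pi.smul_apply, ih (Fin.castSucc _) (by simp), smul_zero] at h1
        rw [e]
        exact (mul_eq_zero.1 h1).resolve_left (hx _).ne'
      · intro j _ hj
        rcases Nat.lt_or_ge j (k + 1) with h | h
        · rw [ih j (by omega), mul_zero]
        · rw [tridiag_eq_zero', zero_mul]
          have : (j : ℕ) ≠ i := fun h => hj (Fin.ext h)
          simp; omega
      · simp
  exact funext fun i => key i i le_rfl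

lemma eigenvector_proportional {x : TridiagParam m} (hx : x ∈ positiveTridiag m) {μ : ℝ}
    {v w : Fin (m + 1) → ℝ} (hv : tridiag x *ᵥ v = μ • v) (hw : tridiag x *ᵥ w = μ • w) :
    v 0 • w = w 0 • v := by
  rw [← sub_eq_zero]
  apply eigenvector_eq_zero hx (μ := μ)
  · rw [Matrix.mulVec_sub, Matrix.mulVec_smul, Matrix.mulVec_smul, hv, hw, smul_sub,
      smul_comm μ, smul_comm μ]
  · simp [mul_comm]

lemma mulVec_column {n : Type*} [Fintype n] [DecidableEq n] {A Q : Matrix n n ℝ} {d : n → ℝ}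
    (hQ : Q ∈ orthogonalGroup n ℝ) (h : A = Q * diagonal d * Q.transpose) (j : n) :
    A *ᵥ (fun i => Q i j) = d j • fun i => Q i j := by
  have h1 : A * Q = Q * diagonal d := by
    rw [h, Matrix.mul_assoc, (mem_orthogonalGroup_iff' n ℝ).1 hQ, Matrix.mul_one]
  ext i
  have := congrFun (congrFun h1 i) j
  rw [Matrix.mul_apply, Matrix.mul_diagonal] at this
  rw [Pi.smul_apply, smul_eq_mul, mul_comm, ← this]
  rfl

lemma sum_column_mul {n : Type*} [Fintype n] [DecidableEq n] {Q : Matrix n n ℝ}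
    (hQ : Q ∈ orthogonalGroup n ℝ) (j k : n) : ∑ i, Q i j * Q i k = if j = k then 1 else 0 := by
  have := congrFun (congrFun ((mem_orthogonalGroup_iff' n ℝ).1 hQ) j) k
  rw [Matrix.mul_apply, Matrix.one_apply] at this
  exact this

lemma sum_row_mul {n : Type*} [Fintype n] [DecidableEq n] {Q : Matrix n n ℝ}
    (hQ : Q ∈ orthogonalGroup n ℝ) (j k : n) : ∑ i, Q j i * Q k i = if j = k then 1 else 0 := by
  have := congrFun (congrFun ((mem_orthogonalGroup_iff n ℝ).1 hQ) j) k
  rw [Matrix.mul_apply, Matrix.one_apply] at this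
  exact this

/-- A zero first entry would annihilate a whole column of Q. Two columns with a common eigenvalue
would be proportional with positive first entries, which contradicts their orthogonality. -/
lemma IsSpectralData.mem_spectralDomain {x : TridiagParam m} (hx : x ∈ positiveTridiag m)
    {y : SpectralParam m} (h : IsSpectralData x y) : y ∈ spectralDomain m := by
  obtain ⟨hm, hn, Q, hQ, hT, h0⟩ := h
  have hc := mulVec_column hQ hT
  have hpos : ∀ i, 0 < y.1 i := by
    intro j
    refine lt_of_le_of_ne (hn j) fun h => ?_
    have := eigenvector_eq_zero hx (hc j) (by rw [h0, ← h])
    have h1 := sum_column_mul hQ j j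
    simp only [funext_iff, Pi.zero_apply] at this
    simp [this] at h1
  refine ⟨?_, hpos, hm.strictMono_of_injective ?_⟩
  · have := sum_row_mul hQ 0 0
    rw [if_pos rfl] at this
    rw [EuclideanSpace.norm_eq, Real.sqrt_eq_one, ← this]
    refine Finset.sum_congr rfl fun i _ => ?_
    rw [h0, Real.norm_eq_abs, sq_abs, sq]
  · intro j k hjk
    by_contra hne
    have h1 := hc k
    rw [← hjk] at h1
    have h2 := eigenvector_proportional hx (hc j) h1
    have h3 : Q 0 j * ∑ i, Q i j * Q i k = Q 0 k * ∑ i, Q i j * Q i j := by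
      rw [Finset.mul_sum, Finset.mul_sum]
      refine Finset.sum_congr rfl fun i _ => ?_
      have : Q 0 j * Q i k = Q 0 k * Q i j := congrFun h2 i
      linear_combination Q i j * this
    rw [sum_column_mul hQ, sum_column_mul hQ, if_neg hne, if_pos rfl, mul_zero, mul_one, h0] at h3
    exact (hpos k).ne h3

/-- Expand a column of Q for the eigenvalue λ_j in the columns of Q': the i-th coefficient is
annihilated by λ'_i − λ_j. If λ_j is no λ'_i, all coefficients vanish, which a unit vector does not
allow. -/
lemma IsSpectralData.range_subset {x : TridiagParam m} {y y' : SpectralParam m}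
    (h : IsSpectralData x y) (h' : IsSpectralData x y') : Set.range y.2 ⊆ Set.range y'.2 := by
  obtain ⟨hm, hn, Q, hQ, hT, h0⟩ := h
  obtain ⟨hm', hn', Q', hQ', hT', h0'⟩ := h'
  rintro _ ⟨j, rfl⟩
  by_contra hne
  set c := fun i => Q i j
  have hc : tridiag x *ᵥ c = y.2 j • c := mulVec_column hQ hT j
  have h1 : Q'.transpose *ᵥ c = 0 := by
    ext i
    have : (y'.2 i - y.2 j) * (Q'.transpose *ᵥ c) i = 0 := by
      have e : Q'.transpose *ᵥ (tridiag x *ᵥ c) = diagonal y'.2 *ᵥ (Q'.transpose *ᵥ c) := by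
        rw [mulVec_mulVec, mulVec_mulVec, hT', Matrix.mul_assoc, ← Matrix.mul_assoc,
          (mem_orthogonalGroup_iff' _ ℝ).1 hQ', Matrix.one_mul]
      rw [hc, mulVec_smul] at e
      have := congrFun e i
      rw [mulVec_diagonal, Pi.smul_apply, smul_eq_mul] at this
      rw [sub_mul, this, sub_self]
    refine (mul_eq_zero.1 this).resolve_left fun h => hne ⟨i, sub_eq_zero.1 h⟩
  have h2 : c = 0 := by
    have := congrArg (Q' *ᵥ ·) h1
    simpa only [mulVec_mulVec, (mem_orthogonalGroup_iff _ ℝ).1 hQ', one_mulVec, mulVec_zero]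
      using this
  have h3 := sum_column_mul hQ j j
  have h4 : ∀ i, Q i j = 0 := congrFun h2
  simp [h4] at h3

/-- Strictly increasing sequences with the same range coincide. Corresponding columns are then
proportional unit vectors, so the squares of their first entries agree, and non-negativity fixes the
sign. -/
lemma IsSpectralData.unique {x : TridiagParam m} (hx : x ∈ positiveTridiag m)
    {y y' : SpectralParam m} (h : IsSpectralData x y) (h' : IsSpectralData x y') : y = y' := by
  have hl : y.2 = y'.2 := StrictMono.range_inj (h.mem_spectralDomain hx).2.2
    (h'.mem_spectralDomain hx).2.2 |>.1 (Set.Subset.antisymm (h.range_subset h') (h'.range_subset h))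
  obtain ⟨hm, hn, Q, hQ, hT, h0⟩ := h
  obtain ⟨hm', hn', Q', hQ', hT', h0'⟩ := h'
  refine Prod.ext ?_ hl
  ext j
  have h2 := eigenvector_proportional hx (mulVec_column hQ hT j)
    (by rw [hl]; exact mulVec_column hQ' hT' j)
  have h3 : Q 0 j * Q 0 j * ∑ i, Q' i j * Q' i j = Q' 0 j * Q' 0 j * ∑ i, Q i j * Q i j := by
    rw [Finset.mul_sum, Finset.mul_sum]
    refine Finset.sum_congr rfl fun i _ => ?_
    have : Q 0 j * Q' i j = Q' 0 j * Q i j := congrFun h2 i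
    rw [mul_mul_mul_comm, this, mul_mul_mul_comm]
  rw [sum_column_mul hQ, sum_column_mul hQ', if_pos rfl, mul_one, mul_one, h0, h0'] at h3
  exact (mul_self_inj (hn j) (hn' j)).1 h3

/-- The spectral theorem supplies an unordered decomposition; its columns are sorted by eigenvalue
and multiplied by signs that make the first row non-negative. -/
lemma exists_isSpectralData (x : TridiagParam m) : ∃ y, IsSpectralData x y := by
  have hH : (tridiag x).IsHermitian := by
    rw [IsHermitian, conjTranspose_eq_transpose_of_trivial, tridiag_transpose]
  obtain ⟨U, hU, d, hT⟩ : ∃ U ∈ orthogonalGroup (Fin (m + 1)) ℝ, ∃ d : Fin (m + 1) → ℝ,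
      tridiag x = U * diagonal d * U.transpose := by
    refine ⟨hH.eigenvectorUnitary, hH.eigenvectorUnitary.2, hH.eigenvalues, ?_⟩
    have := hH.spectral_theorem
    rw [Unitary.conjStarAlgAut_apply] at this
    simpa [star_eq_conjTranspose, Function.comp_def] using this
  set σ := Tuple.sort d
  set s : Fin (m + 1) → ℝ := fun j => if U 0 (σ j) < 0 then -1 else 1
  have hs : ∀ j, s j * s j = 1 := fun j => by simp only [s]; split_ifs <;> norm_num
  refine ⟨(WithLp.toLp 2 fun j => s j * U 0 (σ j), d ∘ σ), Tuple.monotone_sort d, ?_,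
    Matrix.of fun i j => s j * U i (σ j), ?_, ?_, fun i => rfl⟩
  · intro j
    change 0 ≤ s j * U 0 (σ j)
    simp only [s]
    split_ifs <;> linarith
  · rw [mem_orthogonalGroup_iff]
    ext i k
    rw [Matrix.mul_apply, Matrix.one_apply, ← sum_row_mul hU,
      ← Equiv.sum_comp σ fun j => U i j * U k j]
    refine Finset.sum_congr rfl fun j _ => ?_
    change s j * U i (σ j) * (s j * U k (σ j)) = _
    rw [mul_mul_mul_comm, hs, one_mul]
  · rw [hT]
    ext i k
    rw [Matrix.mul_apply, Matrix.mul_apply,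
      ← Equiv.sum_comp σ fun j => (U * diagonal d) i j * U.transpose j k]
    refine Finset.sum_congr rfl fun j _ => ?_
    rw [mul_diagonal, mul_diagonal]
    change U i (σ j) * d (σ j) * U k (σ j) = s j * U i (σ j) * d (σ j) * (s j * U k (σ j))
    linear_combination (-(U i (σ j) * d (σ j) * U k (σ j))) * hs j

lemma isSpectralData_spectralMap (x : TridiagParam m) : IsSpectralData x (spectralMap x) :=
  Classical.epsilon_spec (exists_isSpectralData x)

lemma isSpectralData_iff {x : TridiagParam m} (hx : x ∈ positiveTridiag m) (y : SpectralParam m) :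
    IsSpectralData x y ↔ y = spectralMap x :=
  ⟨fun h => h.unique hx (isSpectralData_spectralMap x),
    fun h => h ▸ isSpectralData_spectralMap x⟩

/-! ### Surjectivity: Gram–Schmidt on Krylov vectors. -/

/-- The Krylov vectors `Λ ^ k q` of a diagonal matrix `Λ`. -/
noncomputable def krylov (y : SpectralParam m) (k : Fin (m + 1)) : EuclideanSpace ℝ (Fin (m + 1)) :=
  WithLp.toLp 2 fun i => y.2 i ^ (k : ℕ) * y.1 i

/-- Multiplication by a diagonal matrix. -/
noncomputable def diagMul (d : Fin (m + 1) → ℝ) :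
    EuclideanSpace ℝ (Fin (m + 1)) →ₗ[ℝ] EuclideanSpace ℝ (Fin (m + 1)) where
  toFun v := WithLp.toLp 2 fun i => d i * v i
  map_add' v w := by ext i; simp [mul_add]
  map_smul' c v := by ext i; simp [mul_left_comm]

lemma diagMul_apply (d : Fin (m + 1) → ℝ) (v : EuclideanSpace ℝ (Fin (m + 1))) (i : Fin (m + 1)) :
    diagMul d v i = d i * v i := rfl

lemma inner_diagMul (d : Fin (m + 1) → ℝ) (v w : EuclideanSpace ℝ (Fin (m + 1))) :
    inner ℝ (diagMul d v) w = ∑ i, v i * d i * w i := by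
  rw [PiLp.inner_apply]
  refine Finset.sum_congr rfl fun i _ => ?_
  rw [diagMul_apply, real_inner_eq_re_inner]
  simp
  ring

lemma inner_diagMul_comm (d : Fin (m + 1) → ℝ) (v w : EuclideanSpace ℝ (Fin (m + 1))) :
    inner ℝ (diagMul d v) w = inner ℝ (diagMul d w) v := by
  rw [inner_diagMul, inner_diagMul]
  exact Finset.sum_congr rfl fun i _ => by ring

lemma diagMul_krylov (y : SpectralParam m) (k : Fin m) :
    diagMul y.2 (krylov y k.castSucc) = krylov y k.succ := by
  ext i
  rw [diagMul_apply]
  simp [krylov, pow_succ']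
  ring

/-- The matrix of Krylov vectors is diag(q) times the Vandermonde matrix of λ. -/
lemma linearIndependent_krylov {y : SpectralParam m} (hq : ∀ i, 0 < y.1 i)
    (hl : Function.Injective y.2) : LinearIndependent ℝ (krylov y) := by
  rw [Fintype.linearIndependent_iff]
  intro g hg
  have h : vandermonde y.2 *ᵥ g = 0 := by
    ext i
    have h1 := congrArg (fun v : EuclideanSpace ℝ (Fin (m + 1)) => v i) hg
    simp only [WithLp.ofLp_sum, Finset.sum_apply, PiLp.smul_apply, krylov, smul_eq_mul,
      PiLp.zero_apply, ← mul_assoc, ← Finset.sum_mul] at h1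
    have h2 := (mul_eq_zero.1 h1).resolve_right (hq i).ne'
    rw [Pi.zero_apply, ← h2, mulVec, dotProduct]
    exact Finset.sum_congr rfl fun k _ => by rw [vandermonde_apply, mul_comm]
  exact congrFun (eq_zero_of_mulVec_eq_zero (det_vandermonde_ne_zero_iff.2 hl) h)

/-- Gram–Schmidt preserves the flag of spans. The form `Iio j` serves comparisons of leading terms,
the form `Iic i` the vanishing of entries far from the diagonal. -/
lemma inner_gramSchmidtNormed_of_mem_span {y : SpectralParam m} {s : Set (Fin (m + 1))}
    {j : Fin (m + 1)} (hs : s = Set.Iio j ∨ ∃ i < j, s = Set.Iic i)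
    (hK : LinearIndependent ℝ (krylov y)) {v : EuclideanSpace ℝ (Fin (m + 1))}
    (hv : v ∈ Submodule.span ℝ (krylov y '' s)) :
    inner ℝ v (gramSchmidtNormed ℝ (krylov y) j) = 0 := by
  have hj : j ∉ s := by
    rcases hs with rfl | ⟨i, hi, rfl⟩
    · simp
    · simpa using hi
  have e : Submodule.span ℝ (krylov y '' s) =
      Submodule.span ℝ (gramSchmidtNormed ℝ (krylov y) '' s) := by
    rw [span_gramSchmidtNormed]
    rcases hs with rfl | ⟨i, hi, rfl⟩
    · rw [span_gramSchmidt_Iio]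
    · rw [span_gramSchmidt_Iic]
  rw [e] at hv
  induction hv using Submodule.span_induction with
  | mem x hx =>
    obtain ⟨i, hi, rfl⟩ := hx
    exact (gramSchmidtNormed_orthonormal hK).2 (fun h => hj (h ▸ hi))
  | zero => exact inner_zero_left _
  | add x y _ _ hx hy => rw [inner_add_left, hx, hy, add_zero]
  | smul a x _ hx => rw [inner_smul_left, hx, mul_zero]

lemma gramSchmidtNormed_mem_span (y : SpectralParam m) (j : Fin (m + 1)) :
    gramSchmidtNormed ℝ (krylov y) j ∈ Submodule.span ℝ (krylov y '' Set.Iic j) := by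
  rw [← span_gramSchmidt_Iic ℝ, ← span_gramSchmidtNormed]
  exact Submodule.subset_span ⟨j, Set.self_mem_Iic, rfl⟩

lemma sub_gramSchmidt_mem_span (y : SpectralParam m) (j : Fin (m + 1)) :
    krylov y j - gramSchmidt ℝ (krylov y) j ∈ Submodule.span ℝ (krylov y '' Set.Iio j) := by
  rw [← span_gramSchmidt_Iio ℝ, gramSchmidt_def, sub_sub_cancel]
  refine Submodule.sum_mem _ fun i hi => ?_
  exact Submodule.span_mono (by
    rw [Set.singleton_subset_iff]
    exact ⟨i, by simpa using hi, rfl⟩) (Submodule.starProjection_apply_mem _ _)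

lemma diagMul_mem_span (y : SpectralParam m) (k : Fin m) {v : EuclideanSpace ℝ (Fin (m + 1))}
    (hv : v ∈ Submodule.span ℝ (krylov y '' Set.Iic k.castSucc)) :
    diagMul y.2 v ∈ Submodule.span ℝ (krylov y '' Set.Iic k.succ) := by
  have h : Submodule.span ℝ (krylov y '' Set.Iic k.castSucc) ≤
      (Submodule.span ℝ (krylov y '' Set.Iic k.succ)).comap (diagMul y.2) := by
    rw [Submodule.span_le]
    rintro _ ⟨i, hi, rfl⟩
    obtain ⟨i, rfl⟩ := Fin.exists_castSucc_eq.2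
      (show i ≠ Fin.last m from (lt_of_le_of_lt hi (Fin.castSucc_lt_last k)).ne)
    rw [SetLike.mem_coe, Submodule.mem_comap, diagMul_krylov]
    exact Submodule.subset_span ⟨_, Fin.succ_le_succ_iff.2 (Fin.castSucc_le_castSucc_iff.1 hi), rfl⟩
  exact h hv

lemma diagMul_mem_span_of_lt (y : SpectralParam m) (k : Fin m)
    {v : EuclideanSpace ℝ (Fin (m + 1))}
    (hv : v ∈ Submodule.span ℝ (krylov y '' Set.Iio k.castSucc)) :
    diagMul y.2 v ∈ Submodule.span ℝ (krylov y '' Set.Iio k.succ) := by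
  have h : Submodule.span ℝ (krylov y '' Set.Iio k.castSucc) ≤
      (Submodule.span ℝ (krylov y '' Set.Iio k.succ)).comap (diagMul y.2) := by
    rw [Submodule.span_le]
    rintro _ ⟨i, hi, rfl⟩
    obtain ⟨i, rfl⟩ := Fin.exists_castSucc_eq.2
      (show i ≠ Fin.last m from (lt_trans hi (Fin.castSucc_lt_last k)).ne)
    rw [SetLike.mem_coe, Submodule.mem_comap, diagMul_krylov]
    exact Submodule.subset_span ⟨_, Fin.succ_lt_succ_iff.2 (Fin.castSucc_lt_castSucc_iff.1 hi), rfl⟩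
  exact h hv

lemma inner_diagMul_gramSchmidtNormed_eq_zero {y : SpectralParam m}
    (hK : LinearIndependent ℝ (krylov y)) {j k : Fin (m + 1)} (h : (j : ℕ) + 1 < k) :
    inner ℝ (diagMul y.2 (gramSchmidtNormed ℝ (krylov y) j)) (gramSchmidtNormed ℝ (krylov y) k)
      = 0 := by
  obtain ⟨j, rfl⟩ := Fin.exists_castSucc_eq.2 (show j ≠ Fin.last m by
    rintro rfl; have := k.2; simp at h; omega)
  refine inner_gramSchmidtNormed_of_mem_span (Or.inr ⟨j.succ, ?_, rfl⟩) hK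
    (diagMul_mem_span y j (gramSchmidtNormed_mem_span y _))
  simpa [Fin.lt_def] using h

/-- Let g be the unnormalised Gram–Schmidt vectors. Modulo the span of the Krylov vectors of index
at most k, Λ g_k, the Krylov vector of index k + 1 and g_{k+1} all agree, so the entry equals
‖g_{k+1}‖ / ‖g_k‖. -/
lemma inner_diagMul_gramSchmidtNormed_pos {y : SpectralParam m}
    (hK : LinearIndependent ℝ (krylov y)) (k : Fin m) :
    0 < inner ℝ (diagMul y.2 (gramSchmidtNormed ℝ (krylov y) k.castSucc))
      (gramSchmidtNormed ℝ (krylov y) k.succ) := by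
  have hg : ∀ j, 0 < ‖gramSchmidt ℝ (krylov y) j‖ := fun j =>
    norm_pos_iff.2 (gramSchmidt_ne_zero j hK)
  have hw : ∀ j, gramSchmidtNormed ℝ (krylov y) j =
    ‖gramSchmidt ℝ (krylov y) j‖⁻¹ • gramSchmidt ℝ (krylov y) j := fun j => rfl
  have h1 := inner_gramSchmidtNormed_of_mem_span (Or.inl rfl) hK
    (diagMul_mem_span_of_lt y k (sub_gramSchmidt_mem_span y _))
  have h2 := inner_gramSchmidtNormed_of_mem_span (Or.inl rfl) hK
    (sub_gramSchmidt_mem_span y k.succ)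
  rw [map_sub, inner_sub_left, diagMul_krylov, sub_eq_zero] at h1
  rw [inner_sub_left, sub_eq_zero] at h2
  rw [hw k.castSucc, map_smul, inner_smul_left, ← h1, h2, hw k.succ, inner_smul_right,
    real_inner_self_eq_norm_sq]
  have := hg k.succ
  have := hg k.castSucc
  simp only [conj_trivial]
  positivity

/-- Every admissible pair of a vector and a sequence of eigenvalues comes from a tridiagonal
matrix with positive sub-diagonal. -/
lemma exists_tridiag_of_mem_spectralDomain {y : SpectralParam m} (hy : y ∈ spectralDomain m) :
    ∃ x ∈ positiveTridiag m, IsSpectralData x y := by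
  obtain ⟨hn, hq, hl⟩ := hy
  have hK := linearIndependent_krylov hq hl.injective
  set w := gramSchmidtNormed ℝ (krylov y) with hw
  have ho : Orthonormal ℝ w := gramSchmidtNormed_orthonormal hK
  -- T is the matrix of Λ in the basis w, so Q has the vectors w_k as its rows.
  refine ⟨(fun k => inner ℝ (diagMul y.2 (w k)) (w k),
    fun k => inner ℝ (diagMul y.2 (w k.castSucc)) (w k.succ)),
    fun k => inner_diagMul_gramSchmidtNormed_pos hK k, hl.monotone, fun i => (hq i).le,
    Matrix.of fun k i => w k i, ?_, ?_, ?_⟩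
  · rw [mem_orthogonalGroup_iff]
    ext i k
    rw [Matrix.mul_apply, Matrix.one_apply, ← orthonormal_iff_ite.1 ho i k, PiLp.inner_apply]
    exact Finset.sum_congr rfl fun j _ => by simp [mul_comm]
  · have e : ∀ i k, (Matrix.of (fun k i => w k i) * diagonal y.2 *
        (Matrix.of fun k i => w k i).transpose) i k = inner ℝ (diagMul y.2 (w i)) (w k) := by
      intro i k
      rw [Matrix.mul_apply, inner_diagMul]
      exact Finset.sum_congr rfl fun j _ => by rw [mul_diagonal]; rfl
    have key : ∀ (x : TridiagParam m), (∀ k, x.1 k = inner ℝ (diagMul y.2 (w k)) (w k)) →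
        (∀ k, x.2 k = inner ℝ (diagMul y.2 (w k.castSucc)) (w k.succ)) →
        ∀ i k, i ≤ k → tridiag x i k = inner ℝ (diagMul y.2 (w i)) (w k) := by
      intro x h1 h2 i k hik
      rcases Nat.lt_or_ge (i + 1 : ℕ) k with h | h
      · rw [tridiag_eq_zero' x h, inner_diagMul_gramSchmidtNormed_eq_zero hK h]
      rcases hik.eq_or_lt with rfl | hlt
      · rw [tridiag_apply_self, h1]
      · have hi : (i : ℕ) < m := by have := k.2; rw [Fin.lt_def] at hlt; omega
        obtain ⟨l, rfl⟩ := Fin.exists_castSucc_eq.2 (show i ≠ Fin.last m by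
          rintro rfl; simp at hi)
        have : k = l.succ := Fin.ext (by rw [Fin.lt_def] at hlt; simp at *; omega)
        rw [this, tridiag_castSucc_succ, h2]
    ext i k
    rw [e]
    rcases le_total i k with h | h
    · exact key _ (fun _ => rfl) (fun _ => rfl) i k h
    · rw [tridiag_comm, inner_diagMul_comm]
      exact key _ (fun _ => rfl) (fun _ => rfl) k i h
  -- The first Krylov vector is Λ⁰q = q, already of norm one, so normalising leaves it unchanged.
  · have h0 : gramSchmidt ℝ (krylov y) 0 = y.1 := by
      rw [gramSchmidt_def, Finset.sum_eq_zero]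
      · ext i
        simp [krylov]
      · intro i hi
        exact absurd (Finset.mem_Iio.1 hi) (Fin.not_lt_zero i)
    intro i
    have : w 0 = y.1 := by
      rw [hw, gramSchmidtNormed, h0, hn]
      simp
    rw [Matrix.of_apply, this]

/-! ### Moments of a tridiagonal matrix and their triangular structure. -/

/-- The tridiagonal parameters `(a, b)` obtained from `((r, b), a)` by forgetting `r`. -/
noncomputable def toTridiag (z : SpectralParam m) : TridiagParam m := (z.2, fun k => z.1 k.succ)

/-- The Krylov vectors `r T ^ k e₀` of the tridiagonal matrix `T` with parameters
`z = ((r, b), a)`. -/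
noncomputable def tridiagKrylov (z : SpectralParam m) (k : ℕ) : Fin (m + 1) → ℝ :=
  z.1 0 • (tridiag (toTridiag z) ^ k *ᵥ Pi.single 0 1)

/-- The moments `r² (T ^ e)₀₀` of the tridiagonal matrix with parameters `z = ((r, b), a)`. -/
noncomputable def tridiagMoment (z : SpectralParam m) (e : ℕ) : ℝ :=
  z.1 0 ^ 2 * (tridiag (toTridiag z) ^ e) 0 0

lemma tridiagKrylov_apply (z : SpectralParam m) (k : ℕ) (i : Fin (m + 1)) :
    tridiagKrylov z k i = z.1 0 * (tridiag (toTridiag z) ^ k) i 0 := by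
  simp [tridiagKrylov]

lemma tridiagKrylov_succ (z : SpectralParam m) (k : ℕ) :
    tridiagKrylov z (k + 1) = tridiag (toTridiag z) *ᵥ tridiagKrylov z k := by
  rw [tridiagKrylov, tridiagKrylov, mulVec_smul, mulVec_mulVec, pow_succ']

lemma tridiagKrylov_dotProduct (z : SpectralParam m) (s t : ℕ) :
    tridiagKrylov z s ⬝ᵥ tridiagKrylov z t = tridiagMoment z (s + t) := by
  rw [tridiagMoment, pow_add, Matrix.mul_apply, dotProduct, Finset.mul_sum]
  refine Finset.sum_congr rfl fun i _ => ?_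
  have : (tridiag (toTridiag z) ^ s) i 0 = (tridiag (toTridiag z) ^ s) 0 i := by
    conv_lhs => rw [← tridiag_transpose, ← transpose_pow]
    rfl
  rw [tridiagKrylov_apply, tridiagKrylov_apply, this]
  ring

lemma tridiagKrylov_eq_zero (z : SpectralParam m) (k : ℕ) (i : Fin (m + 1)) (h : k < i) :
    tridiagKrylov z k i = 0 := by
  induction k generalizing i with
  | zero =>
    have : (0 : Fin (m + 1)) ≠ i := by rintro rfl; simp at h
    simp [tridiagKrylov_apply, this.symm]
  | succ k ih =>
    rw [tridiagKrylov_succ, mulVec, dotProduct]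
    refine Finset.sum_eq_zero fun j _ => ?_
    rcases Nat.lt_or_ge k j with hj | hj
    · rw [ih j hj, mul_zero]
    · rw [tridiag_eq_zero _ (by omega), zero_mul]

/-- The only path from 0 to i in i steps uses each of the first i sub-diagonal entries once. Storing
r in slot 0 of `z.1` makes the prefactor one more term of the same product. -/
lemma tridiagKrylov_apply_self (z : SpectralParam m) (i : Fin (m + 1)) :
    tridiagKrylov z i i = ∏ j ∈ Iic i, z.1 j := by
  induction i using Fin.induction with
  | zero =>
    have : (Iic 0 : Finset (Fin (m + 1))) = {0} := by ext j; simp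
    simp [this, tridiagKrylov_apply]
  | succ k ih =>
    have : (Iic k.succ : Finset (Fin (m + 1))) = insert k.succ (Iic k.castSucc) := by
      ext j
      simp only [mem_Iic, mem_insert, Fin.le_def, Fin.ext_iff, Fin.val_succ, Fin.val_castSucc]
      omega
    rw [this, Finset.prod_insert (by simp [Fin.le_def]), ← ih, Fin.val_succ, tridiagKrylov_succ,
      mulVec, dotProduct, Finset.sum_eq_single k.castSucc]
    · rw [tridiag_succ_castSucc]
      rfl
    · intro j _ hj
      rcases Nat.lt_or_ge k j with h | h
      · rw [tridiagKrylov_eq_zero _ _ _ h, mul_zero]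
      · rw [tridiag_eq_zero, zero_mul]
        have : (j : ℕ) ≠ k := fun h => hj (Fin.ext h)
        simp
        omega
    · simp

lemma prod_Iic_eq (z : SpectralParam m) (i : Fin (m + 1)) :
    ∏ j ∈ Iic i, z.1 j = z.1 i * ∏ j ∈ Iio i, z.1 j := by
  rw [← Finset.Iio_insert, Finset.prod_insert (by simp)]

/-- The shift caused by r puts the entry joining k and k + 1 in slot k + 1 of `z.1`, hence the
maximum of the two indices. -/
lemma tridiag_congr {z z' : SpectralParam m} {i j : Fin (m + 1)}
    (h1 : i = j → z.2 i = z'.2 i) (h2 : i ≠ j → (i : ℕ) ≤ j + 1 → z.1 (max i j) = z'.1 (max i j)) :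
    tridiag (toTridiag z) i j = tridiag (toTridiag z') i j := by
  rcases lt_trichotomy i j with h | rfl | h
  · rcases Nat.lt_or_ge (i + 1) j with hj | hj
    · rw [tridiag_eq_zero' _ hj, tridiag_eq_zero' _ hj]
    · have e := h2 h.ne (by have := Fin.lt_def.1 h; omega)
      rw [max_eq_right h.le] at e
      obtain ⟨j, rfl⟩ := Fin.exists_succ_eq.2 (Fin.ne_zero_of_lt h)
      have : i = j.castSucc := Fin.ext (by have := Fin.lt_def.1 h; simp at *; omega)
      rw [this, tridiag_castSucc_succ, tridiag_castSucc_succ]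
      exact e
  · rw [tridiag_apply_self, tridiag_apply_self]
    exact h1 rfl
  · rcases Nat.lt_or_ge (j + 1) i with hj | hj
    · rw [tridiag_eq_zero _ hj, tridiag_eq_zero _ hj]
    · have e := h2 h.ne' hj
      rw [max_eq_left h.le] at e
      obtain ⟨i, rfl⟩ := Fin.exists_succ_eq.2 (Fin.ne_zero_of_lt h)
      have : j = i.castSucc := Fin.ext (by have := Fin.lt_def.1 h; simp at *; omega)
      rw [this, tridiag_succ_castSucc, tridiag_succ_castSucc]
      exact e

lemma tridiagKrylov_congr {z z' : SpectralParam m} {i : ℕ}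
    (h1 : ∀ j : Fin (m + 1), (j : ℕ) ≤ i → z.1 j = z'.1 j)
    (h2 : ∀ j : Fin (m + 1), (j : ℕ) < i → z.2 j = z'.2 j) {k : ℕ} (hk : k ≤ i) :
    tridiagKrylov z k = tridiagKrylov z' k := by
  induction k with
  | zero => simp [tridiagKrylov, h1 0 (Nat.zero_le _)]
  | succ k ih =>
    ext l
    rw [tridiagKrylov_succ, tridiagKrylov_succ, ih (by omega), mulVec, mulVec, dotProduct,
      dotProduct]
    refine Finset.sum_congr rfl fun j _ => ?_
    rcases Nat.lt_or_ge k j with h | h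
    · rw [tridiagKrylov_eq_zero _ _ _ h, mul_zero, mul_zero]
    · rw [tridiag_congr]
      · rintro rfl; exact h2 _ (by omega)
      · intro _ hl
        refine h1 _ ?_
        rcases max_cases l j with ⟨e, _⟩ | ⟨e, _⟩ <;> rw [e] <;> omega

/-- Slot i of `z.1` enters the i-th Krylov vector only through its last nonzero coordinate, since a
path of i steps has no time to reach i and come back. -/
lemma tridiagKrylov_congr_of_ne {z z' : SpectralParam m} {i l : Fin (m + 1)}
    (h1 : ∀ j < i, z.1 j = z'.1 j) (h2 : ∀ j < i, z.2 j = z'.2 j) (hl : l ≠ i) :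
    tridiagKrylov z i l = tridiagKrylov z' i l := by
  rcases lt_or_gt_of_ne hl with hl | hl
  · obtain ⟨k, rfl⟩ := Fin.exists_succ_eq.2 (Fin.ne_zero_of_lt hl)
    rw [Fin.val_succ, tridiagKrylov_succ, tridiagKrylov_succ,
      tridiagKrylov_congr (z := z) (z' := z') (i := k) (fun j hj => h1 j (by simp [Fin.lt_def]; omega))
        (fun j hj => h2 j (by simp [Fin.lt_def]; omega)) le_rfl, mulVec, mulVec, dotProduct,
      dotProduct]
    refine Finset.sum_congr rfl fun j _ => ?_
    rcases Nat.lt_or_ge k j with h | h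
    · rw [tridiagKrylov_eq_zero _ _ _ h, mul_zero, mul_zero]
    · rw [tridiag_congr]
      · rintro rfl; exact h2 _ hl
      · intro _ _
        exact h1 _ (max_lt hl (by simp [Fin.lt_def]; omega))
  · rw [tridiagKrylov_eq_zero _ _ _ hl, tridiagKrylov_eq_zero _ _ _ hl]

/-- The moment of order 2i is the squared length of the i-th Krylov vector; when the earlier
parameters agree, only the coordinate i contributes to the difference. -/
lemma tridiagMoment_even_sub {z z' : SpectralParam m} {i : Fin (m + 1)}
    (h1 : ∀ j < i, z.1 j = z'.1 j) (h2 : ∀ j < i, z.2 j = z'.2 j) :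
    tridiagMoment z (2 * i) - tridiagMoment z' (2 * i) =
      (z.1 i ^ 2 - z'.1 i ^ 2) * (∏ j ∈ Iio i, z.1 j) ^ 2 := by
  have e : ∏ j ∈ Iio i, z.1 j = ∏ j ∈ Iio i, z'.1 j :=
    Finset.prod_congr rfl fun j hj => h1 j (Finset.mem_Iio.1 hj)
  rw [two_mul, ← tridiagKrylov_dotProduct, ← tridiagKrylov_dotProduct, dotProduct, dotProduct,
    ← Finset.add_sum_erase _ _ (mem_univ i),
    ← Finset.add_sum_erase _ (fun j => tridiagKrylov z' i j * tridiagKrylov z' i j) (mem_univ i),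
    tridiagKrylov_apply_self, tridiagKrylov_apply_self, prod_Iic_eq, prod_Iic_eq, ← e,
    Finset.sum_congr rfl fun j hj => by
      rw [tridiagKrylov_congr_of_ne h1 h2 (Finset.ne_of_mem_erase hj)]]
  ring

/-- The moment of order 2i + 1 is the quadratic form of T at the i-th Krylov vector v. Under the
hypotheses v is common to both sides and supported on indices at most i, where the two matrices
differ only in the entry (i, i). -/
lemma tridiagMoment_odd_sub {z z' : SpectralParam m} {i : Fin (m + 1)}
    (h1 : ∀ j ≤ i, z.1 j = z'.1 j) (h2 : ∀ j < i, z.2 j = z'.2 j) :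
    tridiagMoment z (2 * i + 1) - tridiagMoment z' (2 * i + 1) =
      (z.2 i - z'.2 i) * (∏ j ∈ Iic i, z.1 j) ^ 2 := by
  have e : tridiagKrylov z' i = tridiagKrylov z i :=
    (tridiagKrylov_congr (fun j hj => h1 j hj) (fun j hj => h2 j hj) le_rfl).symm
  rw [show 2 * (i : ℕ) + 1 = i + (i + 1) by ring, ← tridiagKrylov_dotProduct,
    ← tridiagKrylov_dotProduct, tridiagKrylov_succ, tridiagKrylov_succ, e, ← dotProduct_sub,
    ← sub_mulVec, dotProduct, Finset.sum_eq_single i, mulVec, dotProduct, Finset.sum_eq_single i]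
  · rw [tridiagKrylov_apply_self, Matrix.sub_apply, tridiag_apply_self, tridiag_apply_self]
    simp only [toTridiag]
    ring
  · intro j _ hj
    rcases lt_or_gt_of_ne hj with hj | hj
    · rw [Matrix.sub_apply, tridiag_congr (z := z) (z' := z'), sub_self, zero_mul]
      · rintro rfl; exact absurd hj (lt_irrefl _)
      · intro _ _; exact h1 _ (max_le le_rfl hj.le)
    · rw [tridiagKrylov_eq_zero _ _ _ hj, mul_zero]
  · simp
  · intro l _ hl
    rcases lt_or_gt_of_ne hl with hl | hl
    · rw [mulVec, dotProduct, Finset.sum_eq_zero, mul_zero]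
      intro j _
      rcases le_or_gt j i with hj | hj
      · rw [Matrix.sub_apply, tridiag_congr (z := z) (z' := z'), sub_self, zero_mul]
        · rintro rfl; exact h2 _ hl
        · intro _ _; exact h1 _ (max_le hl.le hj)
      · rw [tridiagKrylov_eq_zero _ _ _ hj, mul_zero]
    · rw [tridiagKrylov_eq_zero _ _ _ hl, zero_mul]
  · simp

/-- The exponents `0, …, 2m + 1`, the even ones first. -/
def momentExponent (r : Fin (m + 1) ⊕ Fin (m + 1)) : ℕ :=
  Sum.elim (fun i : Fin (m + 1) => 2 * (i : ℕ)) (fun i : Fin (m + 1) => 2 * (i : ℕ) + 1) r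

/-- The first `2m + 2` moments as a function of `((r, b), a)`. -/
noncomputable def tridiagMomentMap (z : SpectralParam m) : Fin (m + 1) ⊕ Fin (m + 1) → ℝ :=
  fun r => tridiagMoment z (momentExponent r)

/-- The parameters are recovered successively as z₀, a₀, z₁, a₁, …. Positivity makes the
coefficients nonzero and selects the square root at each even moment. -/
lemma tridiagMomentMap_injOn :
    Set.InjOn (tridiagMomentMap (m := m)) {z | ∀ i, 0 < z.1 i} := by
  intro z hz z' hz' h
  have key : ∀ i, z.1 i = z'.1 i ∧ z.2 i = z'.2 i := by
    intro i
    induction i using WellFoundedLT.induction with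
    | ind i ih =>
      have h0 : z.1 i = z'.1 i := by
        have e := tridiagMoment_even_sub (fun j hj => (ih j hj).1) (fun j hj => (ih j hj).2)
        rw [show tridiagMoment z (2 * i) = tridiagMoment z' (2 * i) from congrFun h (Sum.inl i),
          sub_self, eq_comm, mul_eq_zero, sub_eq_zero] at e
        refine (pow_left_inj₀ (hz i).le (hz' i).le two_ne_zero).1 (e.resolve_right ?_)
        exact pow_ne_zero _ (Finset.prod_ne_zero_iff.2 fun j _ => (hz j).ne')
      refine ⟨h0, ?_⟩
      have e := tridiagMoment_odd_sub (z := z) (z' := z') (i := i)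
        (fun j hj => hj.lt_or_eq.elim (fun hj => (ih j hj).1) (fun hj => hj ▸ h0))
        (fun j hj => (ih j hj).2)
      rw [show tridiagMoment z (2 * i + 1) = tridiagMoment z' (2 * i + 1) from
        congrFun h (Sum.inr i), sub_self, eq_comm, mul_eq_zero, sub_eq_zero] at e
      exact e.resolve_right (pow_ne_zero _ (Finset.prod_ne_zero_iff.2 fun j _ => (hz j).ne'))
  refine Prod.ext ?_ (funext fun i => (key i).2)
  ext i
  exact (key i).1

lemma contDiff_tridiag_pow (e : ℕ) (i j : Fin (m + 1)) :
    ContDiff ℝ 1 fun z : SpectralParam m => (tridiag (toTridiag z) ^ e) i j := by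
  induction e generalizing i j with
  | zero => simpa using contDiff_const
  | succ e ih =>
    simp only [pow_succ, Matrix.mul_apply]
    refine ContDiff.sum fun k _ => (ih i k).mul ?_
    simp only [tridiag_apply, toTridiag]
    refine ContDiff.add ?_ (ContDiff.sum fun l _ => ContDiff.add ?_ ?_)
    all_goals split_ifs <;> fun_prop

lemma contDiff_tridiagMomentMap : ContDiff ℝ 1 (tridiagMomentMap (m := m)) := by
  rw [contDiff_pi]
  intro r
  unfold tridiagMomentMap tridiagMoment
  exact ContDiff.mul (by fun_prop) (contDiff_tridiag_pow _ _ _)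

/-! ### Spectral moments and the bijection. -/

/-- The first `2m + 2` moments `∑ q_i² lam_i ^ e` of the spectral measure as a function of
`(q, lam)`. -/
noncomputable def spectralMomentMap (y : SpectralParam m) : Fin (m + 1) ⊕ Fin (m + 1) → ℝ :=
  fun r => ∑ i, y.1 i ^ 2 * y.2 i ^ momentExponent r

lemma IsSpectralData.pow_apply_zero {x : TridiagParam m} {y : SpectralParam m}
    (h : IsSpectralData x y) (e : ℕ) : (tridiag x ^ e) 0 0 = ∑ i, y.1 i ^ 2 * y.2 i ^ e := by
  obtain ⟨-, -, Q, hQ, hT, h0⟩ := h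
  have : tridiag x ^ e = Q * diagonal (y.2 ^ e) * Q.transpose := by
    induction e with
    | zero => simp [(mem_orthogonalGroup_iff _ ℝ).1 hQ]
    | succ e ih =>
      rw [pow_succ, ih]
      conv_lhs => rw [hT]
      calc Q * diagonal (y.2 ^ e) * Q.transpose * (Q * diagonal y.2 * Q.transpose)
          = Q * (diagonal (y.2 ^ e) * (Q.transpose * Q) * diagonal y.2) * Q.transpose := by
            simp only [Matrix.mul_assoc]
        _ = Q * diagonal (y.2 ^ (e + 1)) * Q.transpose := by
            rw [(mem_orthogonalGroup_iff' _ ℝ).1 hQ, Matrix.mul_one, diagonal_mul_diagonal]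
            rfl
  rw [this, Matrix.mul_apply]
  refine Finset.sum_congr rfl fun i _ => ?_
  rw [mul_diagonal, transpose_apply, h0, Pi.pow_apply]
  ring

/-- The parameters `((r, b), a)` of `r` and a tridiagonal matrix with parameters `(a, b)`. -/
noncomputable def withRadius (r : ℝ) (x : TridiagParam m) : SpectralParam m :=
  (WithLp.toLp 2 (Fin.cons r x.2), x.1)

@[simp] lemma toTridiag_withRadius (r : ℝ) (x : TridiagParam m) :
    toTridiag (withRadius r x) = x := rfl

lemma tridiagMomentMap_withRadius {x : TridiagParam m} {y : SpectralParam m}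
    (h : IsSpectralData x y) (r : ℝ) :
    tridiagMomentMap (withRadius r x) = spectralMomentMap (r • y.1, y.2) := by
  ext e
  rw [tridiagMomentMap, tridiagMoment, toTridiag_withRadius, h.pow_apply_zero, spectralMomentMap,
    Finset.mul_sum]
  refine Finset.sum_congr rfl fun i _ => ?_
  simp [withRadius]
  ring

lemma withRadius_pos {r : ℝ} (hr : 0 < r) {x : TridiagParam m} (hx : x ∈ positiveTridiag m)
    (i : Fin (m + 1)) : 0 < (withRadius r x).1 i := by
  refine Fin.cases ?_ (fun k => ?_) i
  · exact hr
  · exact hx k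

lemma spectralMap_injOn : Set.InjOn (spectralMap (m := m)) (positiveTridiag m) := by
  intro x hx x' hx' h
  have h1 := tridiagMomentMap_withRadius (isSpectralData_spectralMap x) 1
  rw [h, ← tridiagMomentMap_withRadius (isSpectralData_spectralMap x') 1] at h1
  have := tridiagMomentMap_injOn (withRadius_pos one_pos hx) (withRadius_pos one_pos hx') h1
  simpa using congrArg toTridiag this

lemma bijOn_spectralMap : Set.BijOn (spectralMap (m := m)) (positiveTridiag m)
    (spectralDomain m) := by
  refine ⟨fun x hx => (isSpectralData_spectralMap x).mem_spectralDomain hx, spectralMap_injOn,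
    fun y hy => ?_⟩
  obtain ⟨x, hx, h⟩ := exists_tridiag_of_mem_spectralDomain hy
  exact ⟨x, hx, ((isSpectralData_iff hx y).1 h).symm⟩

/-! ### Vandermonde and confluent Vandermonde determinants. -/

/-- The order on ι is pulled back along b. This allows triangularity with respect to
`momentExponent`, which interleaves the two summands of the index type. -/
lemma Matrix.det_of_triangular_of_injective {ι : Type*} [Fintype ι] [DecidableEq ι]
    (M : Matrix ι ι ℝ) (b : ι → ℕ) (hb : Function.Injective b)
    (h : ∀ i j, b i < b j → M i j = 0) : M.det = ∏ i, M i i := by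
  let _ : LinearOrder ι := LinearOrder.lift' b hb
  have := Matrix.det_of_isLowerTriangular M fun i j hij => h i j hij
  convert this

lemma momentExponent_injective : Function.Injective (momentExponent (m := m)) := by
  rintro (i | i) (j | j) h <;> simp [momentExponent] at h ⊢ <;> omega

lemma momentExponent_lt (r : Fin (m + 1) ⊕ Fin (m + 1)) :
    momentExponent r < (m + 1) + (m + 1) := by
  rcases r with i | i <;> have := i.2 <;> simp [momentExponent] <;> omega

lemma exists_momentExponent_eq {e : ℕ} (he : e < (m + 1) + (m + 1)) :
    ∃ r : Fin (m + 1) ⊕ Fin (m + 1), momentExponent r = e := by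
  rcases Nat.even_or_odd' e with ⟨k, rfl | rfl⟩
  · exact ⟨Sum.inl ⟨k, by omega⟩, rfl⟩
  · exact ⟨Sum.inr ⟨k, by omega⟩, rfl⟩

/-- Squaring counts each pair in both orders. The resulting product refers to no order on the
indices, so it carries over to sum types. -/
lemma det_vandermonde_sq {n : ℕ} (p : Fin n → ℝ) :
    (vandermonde p).det ^ 2 = ∏ i, ∏ j, if i = j then 1 else |p i - p j| := by
  have h1 : |(vandermonde p).det| = ∏ i, ∏ j, if i < j then |p i - p j| else 1 := by
    rw [det_vandermonde, Finset.abs_prod]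
    refine Finset.prod_congr rfl fun i _ => ?_
    rw [Finset.abs_prod, ← Finset.prod_filter]
    refine Finset.prod_congr (by ext j; simp) fun j _ => abs_sub_comm _ _
  have h2 : |(vandermonde p).det| = ∏ i, ∏ j, if j < i then |p i - p j| else 1 := by
    rw [h1, Finset.prod_comm]
    refine Finset.prod_congr rfl fun i _ => Finset.prod_congr rfl fun j _ => ?_
    rw [abs_sub_comm]
  rw [← sq_abs, sq]
  nth_rewrite 1 [h1]
  rw [h2, ← Finset.prod_mul_distrib]
  refine Finset.prod_congr rfl fun i _ => ?_
  rw [← Finset.prod_mul_distrib]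
  refine Finset.prod_congr rfl fun j _ => ?_
  rcases lt_trichotomy i j with h | rfl | h
  · simp [h, h.ne, h.not_gt]
  · simp
  · simp [h, h.ne', h.not_gt]

lemma det_pow_momentExponent_sq (p : Fin (m + 1) ⊕ Fin (m + 1) → ℝ) :
    (Matrix.of fun r c => p c ^ momentExponent r).det ^ 2 =
      ∏ i, ∏ j, if i = j then 1 else |p i - p j| := by
  have hb : Function.Bijective fun r : Fin (m + 1) ⊕ Fin (m + 1) =>
      (⟨momentExponent r, momentExponent_lt r⟩ : Fin ((m + 1) + (m + 1))) := by
    rw [Fintype.bijective_iff_injective_and_card]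
    exact ⟨fun i j h => momentExponent_injective (Fin.mk.inj h), by simp⟩
  set e := Equiv.ofBijective _ hb
  have he : (Matrix.of fun r c => p c ^ momentExponent r) =
      ((vandermonde (p ∘ e.symm)).transpose).submatrix e e := by
    ext r c
    simp [vandermonde_apply, e]
  rw [he, det_submatrix_equiv_self, det_transpose, det_vandermonde_sq, ← Equiv.prod_comp e]
  refine Finset.prod_congr rfl fun i _ => ?_
  rw [← Equiv.prod_comp e]
  simp

/-- The confluent Vandermonde matrix, each node having multiplicity two. -/
def confluentVandermonde (lam : Fin (m + 1) → ℝ) :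
    Matrix (Fin (m + 1) ⊕ Fin (m + 1)) (Fin (m + 1) ⊕ Fin (m + 1)) ℝ :=
  Matrix.of fun r => Sum.elim (fun j => lam j ^ momentExponent r)
    (fun j => momentExponent r * lam j ^ (momentExponent r - 1))

lemma prod_prod_abs_sub_sub (lam : Fin (m + 1) → ℝ) (h : ℝ) :
    ∏ i, ∏ j, |lam i - lam j - h| =
      |h| ^ (m + 1) * ∏ i, ∏ j, if i = j then 1 else |lam i - lam j - h| := by
  have h1 : ∀ i, ∏ j, |lam i - lam j - h| =
      |h| * ∏ j, if i = j then 1 else |lam i - lam j - h| := by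
    intro i
    rw [← Finset.mul_prod_erase _ _ (mem_univ i),
      ← Finset.mul_prod_erase _ (fun j => if i = j then 1 else |lam i - lam j - h|) (mem_univ i)]
    rw [if_pos rfl, one_mul, sub_self, zero_sub, abs_neg]
    congr 1
    refine Finset.prod_congr rfl fun j hj => ?_
    rw [if_neg (Finset.ne_of_mem_erase hj).symm]
  rw [Finset.prod_congr rfl fun i _ => h1 i, Finset.prod_mul_distrib]
  simp

/-- Replace the derivative columns by difference quotients with step h. Column operations reduce the
determinant to an ordinary Vandermonde determinant at the 2n points λ_j, λ_j + h; the n pairs at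
distance |h| cancel the factors h⁻¹, and h → 0 gives V⁸ for the square. Working with squares avoids
signs. -/
lemma abs_det_confluentVandermonde (lam : Fin (m + 1) → ℝ) :
    |(confluentVandermonde lam).det| = (vandermonde lam).det ^ 4 := by
  set D : ℝ → Matrix (Fin (m + 1) ⊕ Fin (m + 1)) (Fin (m + 1) ⊕ Fin (m + 1)) ℝ := fun h =>
    Matrix.of fun r => Sum.elim (fun j => lam j ^ momentExponent r)
      (fun j => h⁻¹ * ((lam j + h) ^ momentExponent r - lam j ^ momentExponent r)) with hD
  set S : ℝ → ℝ := fun h => ∏ i, ∏ j, if i = j then 1 else |lam i - lam j - h| with hS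
  have hS0 : S 0 = (vandermonde lam).det ^ 2 := by
    rw [det_vandermonde_sq]
    simp only [hS, sub_zero]
  have hSc : Continuous S := by
    refine continuous_finsetProd _ fun i _ => continuous_finsetProd _ fun j _ => ?_
    split_ifs <;> fun_prop
  have h1 : ∀ h, h ≠ 0 → (D h).det ^ 2 = S 0 ^ 2 * (S h * S (-h)) := by
    intro h hh
    -- The block matrix performs the column operations that form the difference quotients; its
    -- determinant is h⁻¹ to the power m + 1.
    have e : D h = (Matrix.of fun r c => (Sum.elim lam (fun j => lam j + h)) c ^ momentExponent r) *
        fromBlocks 1 (-h⁻¹ • 1) 0 (h⁻¹ • 1) := by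
      ext r c
      rcases c with c | c <;>
        simp [Matrix.mul_apply, hD, Fintype.sum_sum_type, Matrix.one_apply]
      ring
    rw [e, det_mul, mul_pow, det_pow_momentExponent_sq, det_fromBlocks_zero₂₁, Fintype.prod_sum_type]
    simp only [Fintype.prod_sum_type, Sum.elim_inl, Sum.elim_inr, Sum.inl.injEq, Sum.inr.injEq,
      reduceCtorEq, if_false, Finset.prod_mul_distrib, add_sub_add_right_eq_sub]
    simp only [← sub_sub]
    have e2 : ∏ i, ∏ j, |lam i + h - lam j| = |h| ^ (m + 1) * S (-h) := by
      rw [← abs_neg h, ← prod_prod_abs_sub_sub]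
      refine Finset.prod_congr rfl fun i _ => Finset.prod_congr rfl fun j _ => ?_
      congr 1
      ring
    rw [e2, prod_prod_abs_sub_sub, det_one, det_smul, det_one]
    simp only [hS, sub_zero, Fintype.card_fin]
    have : |h| ^ (m + 1) * |h| ^ (m + 1) * (h⁻¹ ^ (m + 1)) ^ 2 = 1 := by
      rw [← mul_pow, abs_mul_abs_self, ← pow_mul, mul_comm _ 2, pow_mul, ← mul_pow,
        show h * h * h⁻¹ ^ 2 = 1 by field_simp, one_pow]
    simp only [one_mul, mul_one]
    linear_combination (∏ i, ∏ j, if i = j then (1 : ℝ) else |lam i - lam j|) ^ 2 *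
      ((∏ i, ∏ j, if i = j then (1 : ℝ) else |lam i - lam j - h|) *
      ∏ i, ∏ j, if i = j then (1 : ℝ) else |lam i - lam j - -h|) * this
  have h2 : Tendsto (fun h => (D h).det ^ 2) (𝓝[≠] 0) (𝓝 ((confluentVandermonde lam).det ^ 2)) := by
    have hd : Tendsto D (𝓝[≠] 0) (𝓝 (confluentVandermonde lam)) := by
      refine tendsto_pi_nhds.2 fun r => tendsto_pi_nhds.2 fun c => ?_
      rcases c with c | c
      · exact tendsto_const_nhds
      · exact (hasDerivAt_pow (momentExponent r) (lam c)).tendsto_slope_zero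
    exact (((continuous_id.matrix_det).tendsto _).comp hd).pow 2
  have h3 : Tendsto (fun h => (D h).det ^ 2) (𝓝[≠] 0) (𝓝 (S 0 ^ 2 * (S 0 * S 0))) := by
    have hc : Continuous fun h => S 0 ^ 2 * (S h * S (-h)) := by fun_prop
    have := (hc.tendsto 0).mono_left (nhdsWithin_le_nhds (s := {0}ᶜ))
    rw [neg_zero] at this
    refine this.congr' ?_
    filter_upwards [self_mem_nhdsWithin] with h hh
    exact (h1 h hh).symm
  have h4 := tendsto_nhds_unique h2 h3
  rw [hS0] at h4
  refine (pow_left_inj₀ (abs_nonneg _) (by positivity) two_ne_zero).1 ?_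
  rw [sq_abs, h4]
  ring

/-! ### Jacobians of the two moment maps and their ratio. -/

/-- The standard basis of the space of the `(q, lam)`. -/
noncomputable def spectralBasis (m : ℕ) :
    Module.Basis (Fin (m + 1) ⊕ Fin (m + 1)) ℝ (SpectralParam m) :=
  (EuclideanSpace.basisFun (Fin (m + 1)) ℝ).toBasis.prod (Pi.basisFun ℝ (Fin (m + 1)))

lemma spectralBasis_inl (k : Fin (m + 1)) :
    spectralBasis m (Sum.inl k) = (EuclideanSpace.single k 1, 0) := by
  simp [spectralBasis]

lemma spectralBasis_inr (k : Fin (m + 1)) :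
    spectralBasis m (Sum.inr k) = (0, Pi.single k 1) := by
  simp [spectralBasis]

lemma HasFDerivAt.apply_eq_of_hasDerivAt {E ι : Type*} [NormedAddCommGroup E] [NormedSpace ℝ E]
    [Fintype ι] {F : E → ι → ℝ} {A : E →L[ℝ] ι → ℝ} {z v : E} {r : ι} {d : ℝ}
    (hF : HasFDerivAt F A z) (h : HasDerivAt (fun t : ℝ => F (z + t • v) r) d 0) : A v r = d := by
  have h1 : HasDerivAt (fun t : ℝ => F (z + t • v)) (A v) 0 := hF.hasLineDerivAt v
  exact ((hasDerivAt_pi.1 h1) r).unique h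

lemma hasDerivAt_add_pow (a : ℝ) (n : ℕ) :
    HasDerivAt (fun t : ℝ => (a + t) ^ n) (n * a ^ (n - 1)) 0 := by
  simpa using (hasDerivAt_pow n (a + 0)).comp_const_add a 0

lemma toMatrix_spectralBasis_apply (A : SpectralParam m →L[ℝ] Fin (m + 1) ⊕ Fin (m + 1) → ℝ)
    (r c : Fin (m + 1) ⊕ Fin (m + 1)) :
    LinearMap.toMatrix (spectralBasis m) (Pi.basisFun ℝ _) (A : SpectralParam m →ₗ[ℝ] _) r c =
      A (spectralBasis m c) r := by
  rw [LinearMap.toMatrix_apply, Pi.basisFun_repr]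
  rfl

lemma add_smul_spectralBasis_inl_fst (z : SpectralParam m) (k j : Fin (m + 1)) (t : ℝ) :
    (z + t • spectralBasis m (Sum.inl k)).1 j = z.1 j + if j = k then t else 0 := by
  simp [spectralBasis_inl]

lemma add_smul_spectralBasis_inl_snd (z : SpectralParam m) (k j : Fin (m + 1)) (t : ℝ) :
    (z + t • spectralBasis m (Sum.inl k)).2 j = z.2 j := by
  simp [spectralBasis_inl]

lemma add_smul_spectralBasis_inr_fst (z : SpectralParam m) (k j : Fin (m + 1)) (t : ℝ) :
    (z + t • spectralBasis m (Sum.inr k)).1 j = z.1 j := by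
  simp [spectralBasis_inr]

lemma add_smul_spectralBasis_inr_snd (z : SpectralParam m) (k j : Fin (m + 1)) (t : ℝ) :
    (z + t • spectralBasis m (Sum.inr k)).2 j = z.2 j + if j = k then t else 0 := by
  simp [spectralBasis_inr, Pi.single_apply]

/-- With P_i = z₀⋯z_i, the diagonal entries are 2 z_i (z₀⋯z_{i−1})² and P_i². Multiplied by z_i,
each such pair becomes 2 P_i⁴, so the prefactor ∏ z_i removes the division. -/
lemma det_fderiv_tridiagMomentMap {z : SpectralParam m}
    {A : SpectralParam m →L[ℝ] Fin (m + 1) ⊕ Fin (m + 1) → ℝ}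
    (hA : HasFDerivAt tridiagMomentMap A z) :
    (∏ i, z.1 i) * (LinearMap.toMatrix (spectralBasis m) (Pi.basisFun ℝ _)
      (A : SpectralParam m →ₗ[ℝ] _)).det = 2 ^ (m + 1) * (∏ i, ∏ j ∈ Iic i, z.1 j) ^ 4 := by
  have hll : ∀ i k, i ≤ k → A (spectralBasis m (Sum.inl k)) (Sum.inl i) =
      if i = k then 2 * z.1 i * (∏ j ∈ Iio i, z.1 j) ^ 2 else 0 := by
    intro i k hik
    refine hA.apply_eq_of_hasDerivAt ?_
    -- The difference formula is exact in t, so the partial derivative is that of an explicit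
    -- polynomial in one variable.
    have e : ∀ t : ℝ, tridiagMomentMap (z + t • spectralBasis m (Sum.inl k)) (Sum.inl i) =
        tridiagMoment z (2 * i) - (z.1 i ^ 2 - (z.1 i + if i = k then t else 0) ^ 2) *
          (∏ j ∈ Iio i, z.1 j) ^ 2 := by
      intro t
      have := tridiagMoment_even_sub (z := z) (z' := z + t • spectralBasis m (Sum.inl k)) (i := i)
        (fun j hj => by
          rw [add_smul_spectralBasis_inl_fst, if_neg (hj.trans_le hik).ne, add_zero])
        (fun j hj => by rw [add_smul_spectralBasis_inl_snd])
      rw [add_smul_spectralBasis_inl_fst] at this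
      rw [← this, sub_sub_cancel]
      rfl
    simp only [e]
    by_cases h : i = k
    all_goals simp only [h, if_true, if_false]
    · subst h
      exact ((((hasDerivAt_add_pow (z.1 i) 2).const_sub (z.1 i ^ 2)).mul_const
        ((∏ j ∈ Iio i, z.1 j) ^ 2)).const_sub (tridiagMoment z (2 * i))).congr_deriv (by simp)
    · exact hasDerivAt_const _ _
  have hlr : ∀ i k, i ≤ k → A (spectralBasis m (Sum.inr k)) (Sum.inl i) = 0 := by
    intro i k hik
    refine hA.apply_eq_of_hasDerivAt ?_
    have e : ∀ t : ℝ, tridiagMomentMap (z + t • spectralBasis m (Sum.inr k)) (Sum.inl i) =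
        tridiagMoment z (2 * i) := by
      intro t
      have := tridiagMoment_even_sub (z := z) (z' := z + t • spectralBasis m (Sum.inr k)) (i := i)
        (fun j hj => by rw [add_smul_spectralBasis_inr_fst])
        (fun j hj => by
          rw [add_smul_spectralBasis_inr_snd, if_neg (hj.trans_le hik).ne, add_zero])
      rw [add_smul_spectralBasis_inr_fst, sub_self, zero_mul, sub_eq_zero] at this
      exact this.symm
    simp only [e]
    exact hasDerivAt_const _ _
  have hrl : ∀ i k, i < k → A (spectralBasis m (Sum.inl k)) (Sum.inr i) = 0 := by
    intro i k hik
    refine hA.apply_eq_of_hasDerivAt ?_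
    have e : ∀ t : ℝ, tridiagMomentMap (z + t • spectralBasis m (Sum.inl k)) (Sum.inr i) =
        tridiagMoment z (2 * i + 1) := by
      intro t
      have := tridiagMoment_odd_sub (z := z) (z' := z + t • spectralBasis m (Sum.inl k)) (i := i)
        (fun j hj => by
          rw [add_smul_spectralBasis_inl_fst, if_neg (hj.trans_lt hik).ne, add_zero])
        (fun j hj => by rw [add_smul_spectralBasis_inl_snd])
      rw [add_smul_spectralBasis_inl_snd, sub_self, zero_mul, sub_eq_zero] at this
      exact this.symm
    simp only [e]
    exact hasDerivAt_const _ _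
  have hrr : ∀ i k, i ≤ k → A (spectralBasis m (Sum.inr k)) (Sum.inr i) =
      if i = k then (∏ j ∈ Iic i, z.1 j) ^ 2 else 0 := by
    intro i k hik
    refine hA.apply_eq_of_hasDerivAt ?_
    have e : ∀ t : ℝ, tridiagMomentMap (z + t • spectralBasis m (Sum.inr k)) (Sum.inr i) =
        tridiagMoment z (2 * i + 1) - (z.2 i - (z.2 i + if i = k then t else 0)) *
          (∏ j ∈ Iic i, z.1 j) ^ 2 := by
      intro t
      have := tridiagMoment_odd_sub (z := z) (z' := z + t • spectralBasis m (Sum.inr k)) (i := i)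
        (fun j hj => by rw [add_smul_spectralBasis_inr_fst])
        (fun j hj => by
          rw [add_smul_spectralBasis_inr_snd, if_neg (hj.trans_le hik).ne, add_zero])
      rw [add_smul_spectralBasis_inr_snd] at this
      rw [← this, sub_sub_cancel]
      rfl
    simp only [e]
    by_cases h : i = k
    all_goals simp only [h, if_true, if_false]
    · subst h
      exact (((((hasDerivAt_id' (0 : ℝ)).const_add (z.2 i)).const_sub (z.2 i)).mul_const
        ((∏ j ∈ Iic i, z.1 j) ^ 2)).const_sub (tridiagMoment z (2 * i + 1))).congr_deriv (by simp)
    · exact hasDerivAt_const _ _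
  rw [Matrix.det_of_triangular_of_injective _ momentExponent momentExponent_injective]
  · simp only [Fintype.prod_sum_type, toMatrix_spectralBasis_apply]
    rw [Finset.prod_congr rfl fun i _ => (hll i i le_rfl).trans (if_pos rfl),
      Finset.prod_congr rfl fun i _ => (hrr i i le_rfl).trans (if_pos rfl),
      ← Finset.prod_mul_distrib, ← Finset.prod_mul_distrib, ← Finset.prod_pow,
      show (2 : ℝ) ^ (m + 1) = ∏ _i : Fin (m + 1), 2 by simp, ← Finset.prod_mul_distrib]
    refine Finset.prod_congr rfl fun i _ => ?_
    rw [prod_Iic_eq]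
    ring
  · rintro (i | i) (j | j) h
    all_goals
      rw [toMatrix_spectralBasis_apply]
      simp only [momentExponent, Sum.elim_inl, Sum.elim_inr] at h
    · have hij : i < j := by rw [Fin.lt_def]; omega
      rw [hll i j hij.le, if_neg hij.ne]
    · exact hlr i j (by rw [Fin.le_def]; omega)
    · exact hrl i j (by rw [Fin.lt_def]; omega)
    · have hij : i < j := by rw [Fin.lt_def]; omega
      rw [hrr i j hij.le, if_neg hij.ne]

lemma contDiff_spectralMomentMap : ContDiff ℝ 1 (spectralMomentMap (m := m)) := by
  rw [contDiff_pi]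
  intro r
  unfold spectralMomentMap
  fun_prop

/-- Differentiating q_k² λ_k^e in q_k and in λ_k yields the confluent Vandermonde columns scaled by
2 q_k and q_k². -/
lemma abs_det_fderiv_spectralMomentMap {y : SpectralParam m} (hq : ∀ i, 0 < y.1 i)
    {A : SpectralParam m →L[ℝ] Fin (m + 1) ⊕ Fin (m + 1) → ℝ}
    (hA : HasFDerivAt spectralMomentMap A y) :
    |(LinearMap.toMatrix (spectralBasis m) (Pi.basisFun ℝ _)
      (A : SpectralParam m →ₗ[ℝ] _)).det| =
      2 ^ (m + 1) * (∏ i, y.1 i) ^ 3 * (vandermonde y.2).det ^ 4 := by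
  have hl : ∀ r k, A (spectralBasis m (Sum.inl k)) r = y.2 k ^ momentExponent r * (2 * y.1 k) := by
    intro r k
    refine hA.apply_eq_of_hasDerivAt ?_
    simp only [spectralMomentMap, add_smul_spectralBasis_inl_fst, add_smul_spectralBasis_inl_snd]
    have : ∀ i ∈ univ, HasDerivAt (fun t : ℝ => (y.1 i + if i = k then t else 0) ^ 2 *
        y.2 i ^ momentExponent r)
        (if i = k then y.2 k ^ momentExponent r * (2 * y.1 k) else 0) 0 := by
      intro i _
      split_ifs with h
      · subst h
        exact ((hasDerivAt_add_pow (y.1 i) 2).mul_const (y.2 i ^ momentExponent r)).congr_deriv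
          (by simp [mul_comm])
      · simpa using hasDerivAt_const _ _
    refine (HasDerivAt.fun_sum this).congr_deriv ?_
    rw [Finset.sum_ite_eq' univ k, if_pos (mem_univ k)]
  have hr : ∀ r k, A (spectralBasis m (Sum.inr k)) r =
      momentExponent r * y.2 k ^ (momentExponent r - 1) * y.1 k ^ 2 := by
    intro r k
    refine hA.apply_eq_of_hasDerivAt ?_
    simp only [spectralMomentMap, add_smul_spectralBasis_inr_fst, add_smul_spectralBasis_inr_snd]
    have : ∀ i ∈ univ, HasDerivAt (fun t : ℝ => y.1 i ^ 2 *
        (y.2 i + if i = k then t else 0) ^ momentExponent r)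
        (if i = k then momentExponent r * y.2 k ^ (momentExponent r - 1) * y.1 k ^ 2 else 0) 0 := by
      intro i _
      split_ifs with h
      · subst h
        exact ((hasDerivAt_add_pow (y.2 i) (momentExponent r)).const_mul (y.1 i ^ 2)).congr_deriv
          (mul_comm _ _)
      · simpa using hasDerivAt_const _ _
    refine (HasDerivAt.fun_sum this).congr_deriv ?_
    rw [Finset.sum_ite_eq' univ k, if_pos (mem_univ k)]
  have e : LinearMap.toMatrix (spectralBasis m) (Pi.basisFun ℝ _) (A : SpectralParam m →ₗ[ℝ] _) =
      confluentVandermonde y.2 *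
        diagonal (Sum.elim (fun j => 2 * y.1 j) (fun j => y.1 j ^ 2)) := by
    ext r c
    rw [toMatrix_spectralBasis_apply, mul_diagonal]
    rcases c with c | c
    · rw [hl]; rfl
    · rw [hr]; rfl
  rw [e, det_mul, abs_mul, abs_det_confluentVandermonde, det_diagonal, Fintype.prod_sum_type]
  simp only [Sum.elim_inl, Sum.elim_inr, Finset.prod_mul_distrib, Finset.prod_pow,
    Finset.prod_const, Finset.card_univ, Fintype.card_fin]
  have := Finset.prod_pos fun i (_ : i ∈ univ) => hq i
  rw [abs_of_pos (by positivity)]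
  ring

/-- Equal moments mean equal Gram matrices of Krylov vectors. One factors through the triangular
matrix of the vectors r T^k e₀, the other through diag(q) times Vandermonde. Only orders j + k ≤ 2m
occur, which the first 2m + 2 moments cover. -/
lemma prod_prod_sq_eq {y z : SpectralParam m}
    (h : tridiagMomentMap z = spectralMomentMap y) :
    (∏ i, ∏ j ∈ Iic i, z.1 j) ^ 2 = (∏ i, y.1 i) ^ 2 * (vandermonde y.2).det ^ 2 := by
  set K : Matrix (Fin (m + 1)) (Fin (m + 1)) ℝ := Matrix.of fun i k => tridiagKrylov z k i
  have hK : K.det = ∏ i, ∏ j ∈ Iic i, z.1 j := by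
    rw [← det_transpose, Matrix.det_of_triangular_of_injective _ Fin.val Fin.val_injective]
    · exact Finset.prod_congr rfl fun i _ => tridiagKrylov_apply_self z i
    · intro i j hij
      exact tridiagKrylov_eq_zero _ _ _ hij
  have e : K.transpose * K =
      (diagonal y.1 * vandermonde y.2).transpose * (diagonal y.1 * vandermonde y.2) := by
    ext j k
    rw [Matrix.mul_apply, Matrix.mul_apply]
    change tridiagKrylov z j ⬝ᵥ tridiagKrylov z k = _
    obtain ⟨r, hr⟩ := exists_momentExponent_eq (m := m) (e := j + k)
      (by have := j.2; have := k.2; omega)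
    have h1 := congrFun h r
    rw [tridiagMomentMap, spectralMomentMap, hr] at h1
    rw [tridiagKrylov_dotProduct, h1]
    refine Finset.sum_congr rfl fun i _ => ?_
    rw [transpose_apply, diagonal_mul, diagonal_mul, vandermonde_apply, vandermonde_apply]
    ring
  have h2 := congrArg Matrix.det e
  rw [det_mul, det_mul, det_transpose, det_transpose, hK, det_mul, det_diagonal] at h2
  rw [sq, h2]
  ring

lemma abs_det_mul_prod_eq {y z : SpectralParam m} (hq : ∀ i, 0 < y.1 i) (hz : ∀ i, 0 < z.1 i)
    (h : tridiagMomentMap z = spectralMomentMap y)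
    {A B : SpectralParam m →L[ℝ] Fin (m + 1) ⊕ Fin (m + 1) → ℝ}
    (hA : HasFDerivAt tridiagMomentMap A z) (hB : HasFDerivAt spectralMomentMap B y) :
    |(LinearMap.toMatrix (spectralBasis m) (Pi.basisFun ℝ _) (B : SpectralParam m →ₗ[ℝ] _)).det| =
      (∏ i, z.1 i) / (∏ i, y.1 i) * |(LinearMap.toMatrix (spectralBasis m) (Pi.basisFun ℝ _)
        (A : SpectralParam m →ₗ[ℝ] _)).det| := by
  have hp := Finset.prod_pos fun i (_ : i ∈ univ) => hq i
  have hp' := Finset.prod_pos fun i (_ : i ∈ univ) => hz i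
  have h1 := congrArg abs (det_fderiv_tridiagMomentMap hA)
  rw [abs_mul, abs_of_pos hp', abs_of_nonneg (a := 2 ^ (m + 1) * (∏ i, ∏ j ∈ Iic i, z.1 j) ^ 4)
    (mul_nonneg (by positivity)
    (Even.pow_nonneg (by decide) _))] at h1
  have h2 := prod_prod_sq_eq h
  rw [div_mul_eq_mul_div, h1, abs_det_fderiv_spectralMomentMap hq hB, eq_div_iff hp.ne']
  -- A difference of squares: this factor raises P² = (∏ q_i)² V² to the identity of fourth powers.
  linear_combination (-2 ^ (m + 1) * ((∏ i, ∏ j ∈ Iic i, z.1 j) ^ 2 +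
    (∏ i, y.1 i) ^ 2 * (vandermonde y.2).det ^ 2)) * h2

lemma det_fderiv_tridiagMomentMap_ne_zero {z : SpectralParam m} (hz : ∀ i, 0 < z.1 i)
    {A : SpectralParam m →L[ℝ] Fin (m + 1) ⊕ Fin (m + 1) → ℝ}
    (hA : HasFDerivAt tridiagMomentMap A z) :
    (LinearMap.toMatrix (spectralBasis m) (Pi.basisFun ℝ _)
      (A : SpectralParam m →ₗ[ℝ] _)).det ≠ 0 := by
  intro h
  have h1 := det_fderiv_tridiagMomentMap hA
  rw [h, mul_zero] at h1
  have : 0 < ∏ i, ∏ j ∈ Iic i, z.1 j := Finset.prod_pos fun i _ => Finset.prod_pos fun j _ => hz j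
  exact absurd h1 (by positivity)

/-! ### Homogeneous extension to an open cone and its differentiability. -/

/-- Pairs `(q, lam)` with `q` positive, not necessarily of unit norm, and `lam` strictly
increasing. -/
def spectralCone (m : ℕ) : Set (SpectralParam m) := {y | (∀ i, 0 < y.1 i) ∧ StrictMono y.2}

lemma isOpen_spectralCone : IsOpen (spectralCone m) := by
  have : spectralCone m = {y | ∀ i, 0 < y.1 i} ∩ {y | ∀ k : Fin m, y.2 k.castSucc < y.2 k.succ} := by
    ext y
    simp [spectralCone, Fin.strictMono_iff_lt_succ]
  rw [this]
  refine IsOpen.inter ?_ ?_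
  · rw [Set.ofPred_forall]
    exact isOpen_iInter_of_finite fun i => isOpen_lt continuous_const (by fun_prop)
  · rw [Set.ofPred_forall]
    exact isOpen_iInter_of_finite fun i => isOpen_lt (by fun_prop) (by fun_prop)

lemma isOpen_fst_pos : IsOpen {z : SpectralParam m | ∀ i, 0 < z.1 i} := by
  rw [Set.ofPred_forall]
  exact isOpen_iInter_of_finite fun i => isOpen_lt continuous_const (by fun_prop)

/-- The pair `(q / ‖q‖, lam)`. -/
noncomputable def unitNormalize (y : SpectralParam m) : SpectralParam m := (‖y.1‖⁻¹ • y.1, y.2)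

lemma norm_fst_pos {y : SpectralParam m} (hy : y ∈ spectralCone m) : 0 < ‖y.1‖ := by
  rw [norm_pos_iff]
  intro h
  have := hy.1 0
  rw [h] at this
  exact lt_irrefl _ this

lemma unitNormalize_mem {y : SpectralParam m} (hy : y ∈ spectralCone m) :
    unitNormalize y ∈ spectralDomain m := by
  have hn := norm_fst_pos hy
  refine ⟨?_, fun i => ?_, hy.2⟩
  · simp only [unitNormalize]
    rw [norm_smul, norm_inv, norm_norm, inv_mul_cancel₀ hn.ne']
  · exact mul_pos (inv_pos.2 hn) (hy.1 i)

lemma unitNormalize_eq_self {y : SpectralParam m} (hy : ‖y.1‖ = 1) : unitNormalize y = y := by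
  simp [unitNormalize, hy]

lemma spectralDomain_subset_cone : spectralDomain m ⊆ spectralCone m := fun _ hy => hy.2

lemma inverseSpectralMap_mem {y : SpectralParam m} (hy : y ∈ spectralDomain m) :
    inverseSpectralMap y ∈ positiveTridiag m :=
  Function.invFunOn_mem (bijOn_spectralMap.surjOn hy)

lemma spectralMap_inverseSpectralMap {y : SpectralParam m} (hy : y ∈ spectralDomain m) :
    spectralMap (inverseSpectralMap y) = y :=
  Function.invFunOn_eq (bijOn_spectralMap.surjOn hy)

lemma inverseSpectralMap_spectralMap {x : TridiagParam m} (hx : x ∈ positiveTridiag m) :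
    inverseSpectralMap (spectralMap x) = x :=
  spectralMap_injOn (inverseSpectralMap_mem (bijOn_spectralMap.mapsTo hx)) hx
    (spectralMap_inverseSpectralMap (bijOn_spectralMap.mapsTo hx))

lemma isSpectralData_inverseSpectralMap {y : SpectralParam m} (hy : y ∈ spectralDomain m) :
    IsSpectralData (inverseSpectralMap y) y :=
  (isSpectralData_iff (inverseSpectralMap_mem hy) y).2 (spectralMap_inverseSpectralMap hy).symm

/-- The homogeneous extension `(q, lam) ↦ ((‖q‖, b), a)` of the inverse spectral map. -/
noncomputable def coneMap (y : SpectralParam m) : SpectralParam m :=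
  withRadius ‖y.1‖ (inverseSpectralMap (unitNormalize y))

lemma toTridiag_coneMap (y : SpectralParam m) :
    toTridiag (coneMap y) = inverseSpectralMap (unitNormalize y) := rfl

lemma coneMap_fst_zero (y : SpectralParam m) : (coneMap y).1 0 = ‖y.1‖ := rfl

lemma prod_coneMap_fst (y : SpectralParam m) :
    ∏ i, (coneMap y).1 i = ‖y.1‖ * ∏ k, (inverseSpectralMap (unitNormalize y)).2 k := by
  rw [Fin.prod_univ_succ]
  rfl

lemma coneMap_pos {y : SpectralParam m} (hy : y ∈ spectralCone m) (i : Fin (m + 1)) :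
    0 < (coneMap y).1 i :=
  withRadius_pos (norm_fst_pos hy) (inverseSpectralMap_mem (unitNormalize_mem hy)) i

lemma tridiagMomentMap_coneMap {y : SpectralParam m} (hy : y ∈ spectralCone m) :
    tridiagMomentMap (coneMap y) = spectralMomentMap y := by
  rw [coneMap, tridiagMomentMap_withRadius (isSpectralData_inverseSpectralMap (unitNormalize_mem hy))]
  simp only [unitNormalize]
  rw [smul_smul, mul_inv_cancel₀ (norm_fst_pos hy).ne', one_smul]

/-- A function `h` with `f ∘ h = g`, with values in an open set on which `f` is injective, is
differentiable if `g` is and `f` has an invertible strict derivative. -/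
lemma HasStrictFDerivAt.hasFDerivAt_of_comp_eq {E F G : Type*} [NormedAddCommGroup E]
    [NormedSpace ℝ E] [CompleteSpace E] [NormedAddCommGroup F] [NormedSpace ℝ F]
    [NormedAddCommGroup G] [NormedSpace ℝ G] {f : E → F} {g : G → F} {h : G → E} {U : Set E}
    {y : G} {A : E ≃L[ℝ] F} {B : G →L[ℝ] F} (hf : HasStrictFDerivAt f (A : E →L[ℝ] F) (h y))
    (hg : HasFDerivAt g B y) (hU : IsOpen U) (hfU : Set.InjOn f U)
    (hhU : ∀ᶠ y' in 𝓝 y, h y' ∈ U) (hfh : ∀ᶠ y' in 𝓝 y, f (h y') = g y') :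
    HasFDerivAt h ((A.symm : F →L[ℝ] E).comp B) y := by
  have hy : f (h y) = g y := hfh.self_of_nhds
  have h1 : HasStrictFDerivAt (hf.localInverse f A (h y)) (A.symm : F →L[ℝ] E) (g y) := by
    rw [← hy]; exact hf.to_localInverse
  have h2 : hf.localInverse f A (h y) (g y) = h y := by
    rw [← hy]; exact hf.localInverse_apply_image
  have h3 := h1.hasFDerivAt.comp y hg
  refine h3.congr_of_eventuallyEq ?_
  -- The local inverse composed with g stays in U near y, where injectivity of f identifies it with
  -- h; continuity of h is thus not presupposed.
  have e1 : ∀ᶠ y' in 𝓝 y, hf.localInverse f A (h y) (g y') ∈ U :=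
    h3.continuousAt.eventually (hU.mem_nhds (by
      rw [Function.comp_apply, h2]; exact hhU.self_of_nhds))
  have e2 : ∀ᶠ w in 𝓝 (g y), f (hf.localInverse f A (h y) w) = w := by
    rw [← hy]; exact hf.eventually_right_inverse
  filter_upwards [e1, hg.continuousAt.eventually e2, hhU, hfh] with y' hy1 hy2 hy3 hy4
  exact hfU hy3 hy1 (hy4.trans hy2.symm)

lemma exists_equiv_hasStrictFDerivAt_tridiagMomentMap {z : SpectralParam m} (hz : ∀ i, 0 < z.1 i) :
    ∃ A : SpectralParam m ≃L[ℝ] (Fin (m + 1) ⊕ Fin (m + 1) → ℝ),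
      HasStrictFDerivAt tridiagMomentMap
        (A : SpectralParam m →L[ℝ] (Fin (m + 1) ⊕ Fin (m + 1) → ℝ)) z := by
  have h1 : HasStrictFDerivAt tridiagMomentMap (fderiv ℝ tridiagMomentMap z) z :=
    contDiff_tridiagMomentMap.contDiffAt.hasStrictFDerivAt one_ne_zero
  have hdet := det_fderiv_tridiagMomentMap_ne_zero hz h1.hasFDerivAt
  refine ⟨(LinearEquiv.ofIsUnitDet (isUnit_iff_ne_zero.2 hdet)).toContinuousLinearEquiv, ?_⟩
  refine h1.congr_fderiv (ContinuousLinearMap.ext fun v => ?_)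
  rw [ContinuousLinearEquiv.coe_coe, LinearEquiv.coe_toContinuousLinearEquiv',
    LinearEquiv.ofIsUnitDet_apply]
  rfl

lemma det_toMatrix_comp (A : SpectralParam m →L[ℝ] (Fin (m + 1) ⊕ Fin (m + 1) → ℝ))
    (C : SpectralParam m →L[ℝ] SpectralParam m) :
    (LinearMap.toMatrix (spectralBasis m) (Pi.basisFun ℝ _)
      (A.comp C : SpectralParam m →ₗ[ℝ] _)).det =
    (LinearMap.toMatrix (spectralBasis m) (Pi.basisFun ℝ _)
      (A : SpectralParam m →ₗ[ℝ] _)).det *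
      LinearMap.det (C : SpectralParam m →ₗ[ℝ] SpectralParam m) := by
  rw [← LinearMap.det_toMatrix (spectralBasis m) (C : SpectralParam m →ₗ[ℝ] SpectralParam m),
    ← det_mul, ← LinearMap.toMatrix_comp]
  rfl

/-- The homogeneous extension of the inverse spectral map is differentiable, with
Jacobian `∏ b_i / ∏ q_i` times the norm of `q`. -/
lemma exists_hasFDerivAt_coneMap {y : SpectralParam m} (hy : y ∈ spectralCone m) :
    ∃ A : SpectralParam m →L[ℝ] SpectralParam m, HasFDerivAt coneMap A y ∧
      |A.det| = (∏ i, (coneMap y).1 i) / ∏ i, y.1 i := by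
  obtain ⟨A, hA⟩ := exists_equiv_hasStrictFDerivAt_tridiagMomentMap (coneMap_pos hy)
  have hB : HasFDerivAt spectralMomentMap (fderiv ℝ spectralMomentMap y) y :=
    (contDiff_spectralMomentMap.contDiffAt.hasStrictFDerivAt one_ne_zero).hasFDerivAt
  have hcone := isOpen_spectralCone.mem_nhds hy
  refine ⟨_, hA.hasFDerivAt_of_comp_eq hB isOpen_fst_pos tridiagMomentMap_injOn
    (by filter_upwards [hcone] with y' hy' using coneMap_pos hy')
    (by filter_upwards [hcone] with y' hy' using tridiagMomentMap_coneMap hy'), ?_⟩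
  have key := abs_det_mul_prod_eq hy.1 (coneMap_pos hy) (tridiagMomentMap_coneMap hy)
    hA.hasFDerivAt hB
  -- Chain rule: this factorisation makes the determinant of the cone map the quotient of the two
  -- moment Jacobians.
  have hAB : fderiv ℝ spectralMomentMap y = (A : SpectralParam m →L[ℝ] _).comp
      ((A.symm : _ →L[ℝ] SpectralParam m).comp (fderiv ℝ spectralMomentMap y)) :=
    ContinuousLinearMap.ext fun v => by simp
  rw [hAB, det_toMatrix_comp, abs_mul, mul_comm] at key
  exact mul_right_cancel₀
    (abs_ne_zero.2 (det_fderiv_tridiagMomentMap_ne_zero (coneMap_pos hy) hA.hasFDerivAt)) key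

/-! ### The Jacobian determinant on the sphere. -/

/-- `toTridiag` as a continuous linear map. -/
noncomputable def toTridiagL (m : ℕ) : SpectralParam m →L[ℝ] TridiagParam m :=
  LinearMap.toContinuousLinearMap
    { toFun := toTridiag
      map_add' := fun _ _ => rfl
      map_smul' := fun _ _ => rfl }

lemma toTridiagL_apply (z : SpectralParam m) : toTridiagL m z = toTridiag z := rfl

/-- Slot 0 of the cone map is ‖q‖; its derivative is found by differentiating ‖q‖² in two ways. -/
lemma fderiv_coneMap_apply_fst_zero {y : SpectralParam m} (hy : ‖y.1‖ = 1)
    {A : SpectralParam m →L[ℝ] SpectralParam m} (hA : HasFDerivAt coneMap A y)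
    (v : SpectralParam m) : (A v).1 0 = inner ℝ y.1 v.1 := by
  let p : SpectralParam m →L[ℝ] ℝ :=
    (EuclideanSpace.proj 0).comp (ContinuousLinearMap.fst ℝ _ _)
  have h1 : HasFDerivAt (fun y' : SpectralParam m => ‖y'.1‖) (p.comp A) y :=
    p.hasFDerivAt.comp y hA
  have h2 := h1.pow 2
  have h3 := (ContinuousLinearMap.fst ℝ (EuclideanSpace ℝ (Fin (m + 1)))
    (Fin (m + 1) → ℝ)).hasFDerivAt (x := y) |>.norm_sq
  have h4 := congrArg (fun L => L v) (h2.unique h3)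
  simp [hy] at h4
  exact h4

lemma abs_det_basis_toMatrix (b : OrthonormalBasis (Fin (m + 1)) ℝ
    (EuclideanSpace ℝ (Fin (m + 1)))) :
    |((spectralBasis m).toMatrix (b.toBasis.prod (Pi.basisFun ℝ (Fin (m + 1))))).det| = 1 := by
  have e : (spectralBasis m).toMatrix (b.toBasis.prod (Pi.basisFun ℝ (Fin (m + 1)))) =
      fromBlocks ((EuclideanSpace.basisFun (Fin (m + 1)) ℝ).toBasis.toMatrix b) 0 0 1 := by
    ext (i | i) (j | j) <;> simp [spectralBasis, Module.Basis.toMatrix_apply, Matrix.one_apply,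
      Pi.single_apply]
  rw [e, det_fromBlocks_zero₂₁, det_one, mul_one]
  rcases (EuclideanSpace.basisFun (Fin (m + 1)) ℝ).det_to_matrix_orthonormalBasis_real b with h | h
  · rw [Module.Basis.det_apply] at h; simp [h]
  · rw [Module.Basis.det_apply] at h; simp [h]

/-- The index `(a, b)` followed by the radial direction. -/
noncomputable def radialIndexEquiv (m : ℕ) :
    Unit ⊕ (Fin (m + 1) ⊕ Fin m) ≃ Fin (m + 1) ⊕ Fin (m + 1) :=
  Equiv.ofBijective (Sum.elim (fun _ => Sum.inl 0) (Sum.elim Sum.inr (fun k => Sum.inl k.succ))) (by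
    rw [Fintype.bijective_iff_injective_and_card]
    refine ⟨?_, by simp; ring⟩
    rintro (i | i | i) (j | j | j) h <;> simp at h ⊢
    · exact absurd h (Fin.succ_ne_zero j).symm
    all_goals exact h)

/-- Complete u to an orthonormal basis by q itself. The radial row of the derivative of the cone map
is then (1, 0, …, 0), so its determinant equals that of the remaining block, which is
`jacobianMatrix`. -/
lemma hasJacobianAt_inverseSpectralMap {y : SpectralParam m} (hy : y ∈ spectralDomain m) :
    HasJacobianAt inverseSpectralMap y ((∏ k, (inverseSpectralMap y).2 k) / ∏ i, y.1 i) := by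
  obtain ⟨A, hA, hdet⟩ := exists_hasFDerivAt_coneMap (spectralDomain_subset_cone hy)
  rw [prod_coneMap_fst, unitNormalize_eq_self hy.1, hy.1, one_mul] at hdet
  refine ⟨(toTridiagL m).comp A, ?_, fun u hu hyu => ?_⟩
  · refine (((toTridiagL m).hasFDerivAt.comp y hA).hasFDerivWithinAt).congr (fun y' hy' => ?_) ?_
    · rw [Function.comp_apply, toTridiagL_apply, toTridiag_coneMap, unitNormalize_eq_self hy'.1]
    · rw [Function.comp_apply, toTridiagL_apply, toTridiag_coneMap, unitNormalize_eq_self hy.1]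
  · have ho : Orthonormal ℝ (Fin.cons y.1 u : Fin (m + 1) → EuclideanSpace ℝ (Fin (m + 1))) := by
      rw [orthonormal_iff_ite]
      intro i j
      refine Fin.cases ?_ (fun i => ?_) i <;> refine Fin.cases ?_ (fun j => ?_) j
      · simp [hy.1]
      · simp [hyu, (Fin.succ_ne_zero j).symm]
      · rw [real_inner_comm]
        simp [hyu]
      · simpa using orthonormal_iff_ite.1 hu i j
    let b : OrthonormalBasis (Fin (m + 1)) ℝ (EuclideanSpace ℝ (Fin (m + 1))) :=
      (basisOfOrthonormalOfCardEqFinrank ho (by simp)).toOrthonormalBasis (by simpa using ho)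
    have hb : ∀ i, b i = (Fin.cons y.1 u : Fin (m + 1) → EuclideanSpace ℝ (Fin (m + 1))) i := by
      intro i
      simp [b]
    set W := b.toBasis.prod (Pi.basisFun ℝ (Fin (m + 1))) with hW
    have hWl : ∀ i, W (Sum.inl i) =
        ((Fin.cons y.1 u : Fin (m + 1) → EuclideanSpace ℝ (Fin (m + 1))) i, 0) := by
      intro i
      simp [hW, hb]
    have hWr : ∀ i, W (Sum.inr i) = (0, Pi.single i 1) := by
      intro i
      simp [hW]
    set X := LinearMap.toMatrix W (spectralBasis m) (A : SpectralParam m →ₗ[ℝ] SpectralParam m)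
      with hX
    have hXdet : |X.det| = |A.det| := by
      have e : X = LinearMap.toMatrix (spectralBasis m) (spectralBasis m)
          (A : SpectralParam m →ₗ[ℝ] SpectralParam m) * (spectralBasis m).toMatrix W :=
        (linearMap_toMatrix_mul_basis_toMatrix _ _ _ _).symm
      rw [e, det_mul, abs_mul, abs_det_basis_toMatrix, mul_one, LinearMap.det_toMatrix]
    have hXl : ∀ i c, X (Sum.inl i) c = (A (W c)).1 i := by
      intro i c
      simp [hX, LinearMap.toMatrix_apply, spectralBasis]
    have hXr : ∀ i c, X (Sum.inr i) c = (A (W c)).2 i := by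
      intro i c
      simp [hX, LinearMap.toMatrix_apply, spectralBasis]
    -- C holds the derivatives of (a, b) in the direction q; block triangularity makes its value
    -- irrelevant.
    have e : ∃ C, X.submatrix (radialIndexEquiv m) (radialIndexEquiv m) =
        fromBlocks (1 : Matrix Unit Unit ℝ) 0 C (jacobianMatrix ((toTridiagL m).comp A) u) := by
      refine ⟨(X.submatrix (radialIndexEquiv m) (radialIndexEquiv m)).toBlocks₂₁, ?_⟩
      rw [← fromBlocks_toBlocks (X.submatrix (radialIndexEquiv m) (radialIndexEquiv m))]
      have hr : ∀ c, (A (W c)).1 0 = inner ℝ y.1 (W c).1 := fun c =>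
        fderiv_coneMap_apply_fst_zero hy.1 hA _
      congr 1
      · ext i j
        change X (Sum.inl 0) (Sum.inl 0) = _
        rw [hXl, hr, hWl]
        simp [hy.1]
      · ext i (j | j)
        · change X (Sum.inl 0) (Sum.inr j) = _
          rw [hXl, hr, hWr]
          simp
        · change X (Sum.inl 0) (Sum.inl j.succ) = _
          rw [hXl, hr, hWl]
          simp [hyu]
      · ext (i | i) (j | j)
        · change X (Sum.inr i) (Sum.inr j) = _
          rw [hXr, hWr]
          rfl
        · change X (Sum.inr i) (Sum.inl j.succ) = _
          rw [hXr, hWl]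
          rfl
        · change X (Sum.inl i.succ) (Sum.inr j) = _
          rw [hXl, hWr]
          rfl
        · change X (Sum.inl i.succ) (Sum.inl j.succ) = _
          rw [hXl, hWl]
          rfl
    obtain ⟨C, hC⟩ := e
    rw [← hdet, ← hXdet, ← det_submatrix_equiv_self (radialIndexEquiv m), hC,
      det_fromBlocks_zero₁₂, det_one, one_mul]

/-! ### Change of variables in the integral. -/

/-- Integration in polar coordinates. -/
lemma lintegral_eq_lintegral_toSphere {E : Type*} [NormedAddCommGroup E] [NormedSpace ℝ E]
    [FiniteDimensional ℝ E] [Nontrivial E] [MeasurableSpace E] [BorelSpace E] (μ : Measure E)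
    [μ.IsAddHaarMeasure] {g : E → ENNReal} (hg : Measurable g) :
    ∫⁻ x, g x ∂μ = ∫⁻ s, ∫⁻ r in Set.Ioi (0 : ℝ),
      ENNReal.ofReal (r ^ (Module.finrank ℝ E - 1)) * g (r • (s : E)) ∂volume ∂μ.toSphere := by
  have h0 : ∫⁻ x, g x ∂μ = ∫⁻ x : ({0}ᶜ : Set E), g x ∂(μ.comap (↑)) := by
    rw [lintegral_subtype_comap (measurableSet_singleton _).compl, restrict_compl_singleton]
  have h1 : ∫⁻ x : ({0}ᶜ : Set E), g x ∂(μ.comap (↑)) =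
      ∫⁻ p, g ((p.2 : ℝ) • (p.1 : E)) ∂(μ.toSphere.prod
        (Measure.volumeIoiPow (Module.finrank ℝ E - 1))) := by
    rw [← μ.measurePreserving_homeomorphUnitSphereProd.lintegral_comp_emb
      (Homeomorph.measurableEmbedding _)]
    refine lintegral_congr fun x => ?_
    have := congrArg Subtype.val ((homeomorphUnitSphereProd E).symm_apply_apply x)
    rw [homeomorphUnitSphereProd_symm_apply_coe] at this
    rw [this]
  rw [h0, h1, lintegral_prod]
  · refine lintegral_congr fun s => ?_
    have hm : Measurable fun r : Set.Ioi (0 : ℝ) => g ((r : ℝ) • (s : E)) := by fun_prop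
    rw [Measure.volumeIoiPow, lintegral_withDensity_eq_lintegral_mul _ (by fun_prop) hm,
      ← lintegral_subtype_comap measurableSet_Ioi]
    rfl
  · exact (hg.comp (by fun_prop)).aemeasurable

lemma measurePreserving_toTridiag :
    MeasurePreserving
    (fun z => (z.1 0, toTridiag z) : SpectralParam m → ℝ × TridiagParam m) := by
  have h1 : MeasurePreserving (Prod.map WithLp.ofLp id :
      SpectralParam m → (Fin (m + 1) → ℝ) × (Fin (m + 1) → ℝ)) :=
    (PiLp.volume_preserving_ofLp _).prod (MeasurePreserving.id _)
  have h2 : MeasurePreserving (Prod.map (MeasurableEquiv.piFinSuccAbove (fun _ => ℝ) 0) id :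
      (Fin (m + 1) → ℝ) × (Fin (m + 1) → ℝ) → (ℝ × (Fin m → ℝ)) × (Fin (m + 1) → ℝ)) :=
    (volume_preserving_piFinSuccAbove (fun _ => ℝ) 0).prod (MeasurePreserving.id _)
  have h3 : MeasurePreserving (MeasurableEquiv.prodAssoc :
      (ℝ × (Fin m → ℝ)) × (Fin (m + 1) → ℝ) ≃ᵐ ℝ × ((Fin m → ℝ) × (Fin (m + 1) → ℝ))) :=
    volume_preserving_prodAssoc
  have h4 : MeasurePreserving (Prod.map id Prod.swap :
      ℝ × ((Fin m → ℝ) × (Fin (m + 1) → ℝ)) → ℝ × TridiagParam m) :=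
    (MeasurePreserving.id _).prod Measure.measurePreserving_swap
  exact h4.comp (h3.comp (h2.comp h1))

lemma measurableSet_positiveTridiag : MeasurableSet (positiveTridiag m) := by
  rw [positiveTridiag, Set.ofPred_forall]
  exact MeasurableSet.iInter fun k => measurableSet_lt measurable_const (by fun_prop)

/-- The added radius ranges over (0, 1), an interval of length one, so it leaves the integral
unchanged. -/
lemma lintegral_positiveTridiag {f : TridiagParam m → ENNReal} (hf : Measurable f) :
    ∫⁻ x in positiveTridiag m, f x =
      ∫⁻ z in {z : SpectralParam m | (∀ i, 0 < z.1 i) ∧ z.1 0 < 1}, f (toTridiag z) := by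
  have hs : {z : SpectralParam m | (∀ i, 0 < z.1 i) ∧ z.1 0 < 1} =
      (fun z : SpectralParam m => (z.1 0, toTridiag z)) ⁻¹' (Set.Ioo 0 1 ×ˢ positiveTridiag m) := by
    ext z
    simp only [Set.mem_ofPred_eq, Set.mem_preimage, Set.mem_prod, Set.mem_Ioo, positiveTridiag,
      toTridiag, Fin.forall_fin_succ (P := fun i => 0 < z.1 i)]
    tauto
  have hm : Measurable fun p : ℝ × TridiagParam m => f p.2 := hf.comp measurable_snd
  rw [hs, measurePreserving_toTridiag.setLIntegral_comp_preimage
    (measurableSet_Ioo.prod measurableSet_positiveTridiag) hm, Measure.volume_eq_prod ℝ,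
    ← Measure.prod_restrict, lintegral_prod _ hm.aemeasurable]
  simp

lemma coneMap_injOn : Set.InjOn (coneMap (m := m)) (spectralCone m) := by
  intro y hy y' hy' h
  have hn : ‖y.1‖ = ‖y'.1‖ := by rw [← coneMap_fst_zero, h, coneMap_fst_zero]
  have h1 : unitNormalize y = unitNormalize y' := by
    rw [← spectralMap_inverseSpectralMap (unitNormalize_mem hy), ← toTridiag_coneMap, h,
      toTridiag_coneMap, spectralMap_inverseSpectralMap (unitNormalize_mem hy')]
  simp only [unitNormalize, Prod.mk.injEq, hn] at h1
  exact Prod.ext (smul_right_injective _ (inv_ne_zero (norm_fst_pos hy').ne') h1.1) h1.2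

lemma unitNormalize_smul {r : ℝ} (hr : 0 < r) (y : SpectralParam m) :
    unitNormalize (r • y.1, y.2) = unitNormalize y := by
  simp only [unitNormalize]
  rw [norm_smul, Real.norm_of_nonneg hr.le, smul_smul, _root_.mul_inv_rev, mul_assoc,
    inv_mul_cancel₀ hr.ne', mul_one]

lemma coneMap_image : coneMap '' {y | y ∈ spectralCone m ∧ ‖y.1‖ < 1} =
    {z : SpectralParam m | (∀ i, 0 < z.1 i) ∧ z.1 0 < 1} := by
  ext z
  constructor
  · rintro ⟨y, ⟨hy, h1⟩, rfl⟩
    exact ⟨coneMap_pos hy, h1⟩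
  · rintro ⟨hz, h1⟩
    have hx : toTridiag z ∈ positiveTridiag m := fun k => hz k.succ
    have hy := bijOn_spectralMap.mapsTo hx
    set y := spectralMap (toTridiag z)
    have hn : ‖z.1 0 • y.1‖ = z.1 0 := by
      rw [norm_smul, hy.1, mul_one, Real.norm_of_nonneg (hz 0).le]
    refine ⟨(z.1 0 • y.1, y.2), ⟨⟨fun i => mul_pos (hz 0) (hy.2.1 i), hy.2.2⟩, ?_⟩, ?_⟩
    · rw [hn]; exact h1
    · rw [coneMap, unitNormalize_smul (hz 0), unitNormalize_eq_self hy.1,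
        inverseSpectralMap_spectralMap hx, hn]
      refine Prod.ext ?_ rfl
      ext i
      refine Fin.cases rfl (fun k => rfl) i

lemma spectralCone_smul_iff {r : ℝ} (hr : 0 < r) (y : SpectralParam m) :
    (r • y.1, y.2) ∈ spectralCone m ↔ y ∈ spectralCone m := by
  simp [spectralCone, hr]

/-- The integrand `f(a, b) ∏ b_i / ∏ q_i` of the change of variables, extended by zero. -/
noncomputable def coneIntegrand (f : TridiagParam m → ENNReal) : SpectralParam m → ENNReal :=
  (spectralCone m).indicator fun y => f (inverseSpectralMap (unitNormalize y)) *
    ENNReal.ofReal ((∏ k, (inverseSpectralMap (unitNormalize y)).2 k) / ∏ i, y.1 i)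

/-- The inverse map is controlled only on the cone, where differentiability makes it continuous; it
is replaced by zero elsewhere. -/
lemma measurable_coneIntegrand {f : TridiagParam m → ENNReal} (hf : Measurable f) :
    Measurable (coneIntegrand f) := by
  classical
  have hc : ContinuousOn (fun y : SpectralParam m => inverseSpectralMap (unitNormalize y))
      (spectralCone m) := by
    intro y hy
    obtain ⟨A, hA, -⟩ := exists_hasFDerivAt_coneMap hy
    exact ((toTridiagL m).continuous.continuousAt.comp hA.continuousAt).continuousWithinAt
  have hP : Measurable ((spectralCone m).piecewise
      (fun y => inverseSpectralMap (unitNormalize y)) (fun _ => 0)) :=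
    hc.measurable_piecewise continuousOn_const isOpen_spectralCone.measurableSet
  set P := (spectralCone m).piecewise
      (fun y => inverseSpectralMap (unitNormalize y)) (fun _ => 0)
  have e : coneIntegrand f = (spectralCone m).indicator fun y => f (P y) *
      ENNReal.ofReal ((∏ k, (P y).2 k) / ∏ i, y.1 i) := by
    refine Set.indicator_congr fun y hy => ?_
    simp only [P, Set.piecewise_eq_of_mem _ _ _ hy]
  rw [e]
  refine Measurable.indicator ?_ isOpen_spectralCone.measurableSet
  refine (hf.comp hP).mul (ENNReal.measurable_ofReal.comp (Measurable.div ?_ (by fun_prop)))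
  exact Finset.measurable_fun_prod _ fun k _ => (measurable_pi_apply k).comp (hP.snd)

/-- Only ∏ q_i depends on the scale of q, and it is homogeneous of degree m + 1. -/
lemma coneIntegrand_smul (f : TridiagParam m → ENNReal) {r : ℝ} (hr : 0 < r) (y : SpectralParam m) :
    coneIntegrand f (r • y.1, y.2) =
      ENNReal.ofReal ((r ^ (m + 1))⁻¹) * coneIntegrand f y := by
  by_cases hy : y ∈ spectralCone m
  · rw [coneIntegrand, Set.indicator_of_mem ((spectralCone_smul_iff hr y).2 hy),
      Set.indicator_of_mem hy, unitNormalize_smul hr, mul_left_comm,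
      ← ENNReal.ofReal_mul (by positivity)]
    congr 2
    simp [Finset.prod_mul_distrib]
    ring
  · rw [coneIntegrand, Set.indicator_of_notMem (mt (spectralCone_smul_iff hr y).1 hy),
      Set.indicator_of_notMem hy, mul_zero]

lemma lintegral_eq_lintegral_coneIntegrand (f : TridiagParam m → ENNReal) :
    ∫⁻ z in {z : SpectralParam m | (∀ i, 0 < z.1 i) ∧ z.1 0 < 1}, f (toTridiag z) =
      ∫⁻ y : SpectralParam m, (Set.Iio 1).indicator ENNReal.ofReal ‖y.1‖ * coneIntegrand f y := by
  have hO : MeasurableSet {y : SpectralParam m | y ∈ spectralCone m ∧ ‖y.1‖ < 1} :=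
    isOpen_spectralCone.measurableSet.inter (measurableSet_lt
      (measurable_norm.comp measurable_fst) measurable_const)
  have : (volume : Measure (SpectralParam m)).IsAddHaarMeasure :=
    Measure.prod.instIsAddHaarMeasure (volume : Measure (EuclideanSpace ℝ (Fin (m + 1))))
      (volume : Measure (Fin (m + 1) → ℝ))
  choose! A hA hdet using fun (y : SpectralParam m) (hy : y ∈ spectralCone m) =>
    exists_hasFDerivAt_coneMap hy
  rw [← coneMap_image, lintegral_image_eq_lintegral_abs_det_fderiv_mul volume hO
    (fun y hy => (hA y hy.1).hasFDerivWithinAt) (coneMap_injOn.mono fun y hy => hy.1),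
    ← lintegral_indicator hO]
  refine lintegral_congr fun y => ?_
  by_cases hy : y ∈ spectralCone m
  · by_cases h1 : ‖y.1‖ < 1
    · rw [Set.indicator_of_mem (show y ∈ {y | y ∈ spectralCone m ∧ ‖y.1‖ < 1} from ⟨hy, h1⟩),
        Set.indicator_of_mem (show ‖y.1‖ ∈ Set.Iio 1 from h1), coneIntegrand,
        Set.indicator_of_mem hy, hdet y hy, prod_coneMap_fst, mul_div_assoc,
        ENNReal.ofReal_mul (norm_nonneg _), toTridiag_coneMap]
      ring
    · rw [Set.indicator_of_notMem (fun h => h1 h.2), Set.indicator_of_notMem (by simpa using h1),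
        zero_mul]
  · rw [Set.indicator_of_notMem (fun h => hy h.1), coneIntegrand, Set.indicator_of_notMem hy,
      mul_zero]

/-- In polar coordinates the powers of r cancel: r^m from the volume element, r from the weight ‖q‖,
and r^{−(m+1)} from homogeneity. What remains is the length of (0, 1). -/
lemma lintegral_fst_coneIntegrand {f : TridiagParam m → ENNReal} (hf : Measurable f)
    (lam : Fin (m + 1) → ℝ) :
    ∫⁻ q : EuclideanSpace ℝ (Fin (m + 1)),
        (Set.Iio 1).indicator ENNReal.ofReal ‖q‖ * coneIntegrand f (q, lam) =
      ∫⁻ s : Metric.sphere (0 : EuclideanSpace ℝ (Fin (m + 1))) 1,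
        coneIntegrand f ((s : EuclideanSpace ℝ (Fin (m + 1))), lam)
          ∂(volume : Measure (EuclideanSpace ℝ (Fin (m + 1)))).toSphere := by
  have hi : Measurable ((Set.Iio (1 : ℝ)).indicator ENNReal.ofReal) :=
    ENNReal.measurable_ofReal.indicator measurableSet_Iio
  rw [lintegral_eq_lintegral_toSphere]
  · refine lintegral_congr fun s => ?_
    have h : ∀ r ∈ Set.Ioi (0 : ℝ), ENNReal.ofReal (r ^ (Module.finrank ℝ
        (EuclideanSpace ℝ (Fin (m + 1))) - 1)) *
        ((Set.Iio 1).indicator ENNReal.ofReal ‖r • (s : EuclideanSpace ℝ (Fin (m + 1)))‖ *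
          coneIntegrand f (r • (s : EuclideanSpace ℝ (Fin (m + 1))), lam)) =
        (Set.Iio 1).indicator 1 r * coneIntegrand f ((s : EuclideanSpace ℝ (Fin (m + 1))), lam) := by
      intro r hr
      have hr' : 0 < r := hr
      rw [norm_smul, norm_eq_of_mem_sphere, mul_one, Real.norm_of_nonneg hr'.le,
        coneIntegrand_smul f hr' ((s : EuclideanSpace ℝ (Fin (m + 1))), lam), finrank_euclideanSpace,
        Fintype.card_fin, Nat.add_sub_cancel]
      by_cases h1 : r < 1
      · rw [Set.indicator_of_mem (show r ∈ Set.Iio 1 from h1),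
          Set.indicator_of_mem (show r ∈ Set.Iio 1 from h1), ← mul_assoc, ← mul_assoc,
          ← ENNReal.ofReal_mul (by positivity), ← ENNReal.ofReal_mul (by positivity), ← pow_succ,
          mul_inv_cancel₀ (by positivity)]
        simp
      · rw [Set.indicator_of_notMem (by simpa using h1), Set.indicator_of_notMem (by simpa using h1)]
        simp
    rw [setLIntegral_congr_fun measurableSet_Ioi h, lintegral_mul_const _
      (measurable_one.indicator measurableSet_Iio), lintegral_indicator measurableSet_Iio,
      Measure.restrict_restrict measurableSet_Iio]
    simp [Set.Iio_inter_Ioi]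
  · exact (hi.comp measurable_norm).mul ((measurable_coneIntegrand hf).comp (by fun_prop))

lemma measurable_sphere_coe_prod :
    Measurable (fun p => (p.1, p.2) : Metric.sphere (0 : EuclideanSpace ℝ (Fin (m + 1))) 1 ×
      (Fin (m + 1) → ℝ) → SpectralParam m) :=
  (measurable_subtype_coe.comp measurable_fst).prodMk measurable_snd

open Classical in
lemma lintegral_coneIntegrand_sphere (f : TridiagParam m → ENNReal) :
    ∫⁻ p in {p : Metric.sphere (0 : EuclideanSpace ℝ (Fin (m + 1))) 1 × (Fin (m + 1) → ℝ) |
        ((p.1 : EuclideanSpace ℝ (Fin (m + 1))), p.2) ∈ spectralDomain m},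
      f (inverseSpectralMap ((p.1 : EuclideanSpace ℝ (Fin (m + 1))), p.2)) *
        ENNReal.ofReal ((∏ k, (inverseSpectralMap
          ((p.1 : EuclideanSpace ℝ (Fin (m + 1))), p.2)).2 k) /
            ∏ i, (p.1 : EuclideanSpace ℝ (Fin (m + 1))) i) ∂(surfaceProd m) =
    ∫⁻ p, coneIntegrand f ((p.1 : EuclideanSpace ℝ (Fin (m + 1))), p.2) ∂(surfaceProd m) := by
  have hs : {p : Metric.sphere (0 : EuclideanSpace ℝ (Fin (m + 1))) 1 × (Fin (m + 1) → ℝ) |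
        ((p.1 : EuclideanSpace ℝ (Fin (m + 1))), p.2) ∈ spectralDomain m} =
      (fun p => ((p.1 : EuclideanSpace ℝ (Fin (m + 1))), p.2)) ⁻¹' spectralCone m := by
    ext p
    exact ⟨fun h => h.2, fun h => ⟨norm_eq_of_mem_sphere p.1, h⟩⟩
  rw [hs, ← lintegral_indicator (measurable_sphere_coe_prod isOpen_spectralCone.measurableSet)]
  refine lintegral_congr fun p => ?_
  have hp := unitNormalize_eq_self (y := ((p.1 : EuclideanSpace ℝ (Fin (m + 1))), p.2))
    (norm_eq_of_mem_sphere p.1)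
  rw [coneIntegrand, Set.indicator_apply, Set.indicator_apply, hp]
  rfl

/-- The change of variables formula for the inverse spectral map. -/
lemma lintegral_positiveTridiag_eq {f : TridiagParam m → ENNReal} (hf : Measurable f) :
    ∫⁻ x in positiveTridiag m, f x =
      ∫⁻ p, coneIntegrand f ((p.1 : EuclideanSpace ℝ (Fin (m + 1))), p.2) ∂(surfaceProd m) := by
  have hi : Measurable ((Set.Iio (1 : ℝ)).indicator ENNReal.ofReal) :=
    ENNReal.measurable_ofReal.indicator measurableSet_Iio
  have hm := measurable_coneIntegrand hf
  -- Tonelli with λ outermost on both sides, so that polar coordinates apply to q for each fixed λ.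
  rw [lintegral_positiveTridiag hf, lintegral_eq_lintegral_coneIntegrand, Measure.volume_eq_prod,
    lintegral_prod_symm, surfaceProd, lintegral_prod_symm]
  · exact lintegral_congr fun lam => lintegral_fst_coneIntegrand hf lam
  · exact (hm.comp measurable_sphere_coe_prod).aemeasurable
  · exact ((hi.comp (measurable_norm.comp measurable_fst)).mul hm).aemeasurable

end

/-- Matrices have size `n = m + 1`. The map `T ↦ (q, lam)` is a well-defined bijection, and the
Jacobian of `(q, lam) ↦ (a, b)` is `∏ b_i / ∏ q_i`, both as a determinant of derivatives and in the
change of variables `da db = J dq dlam`. -/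
theorem lemma2p3 (m : ℕ) :
    (∀ x ∈ positiveTridiag m, ∀ y : SpectralParam m, IsSpectralData x y ↔ y = spectralMap x) ∧
    Set.BijOn spectralMap (positiveTridiag m) (spectralDomain m) ∧
    (∀ x ∈ positiveTridiag m,
      HasJacobianAt inverseSpectralMap (spectralMap x)
        ((∏ k, x.2 k) / ∏ i, (spectralMap x).1 i)) ∧
    (∀ f : TridiagParam m → ENNReal, Measurable f →
      ∫⁻ x in positiveTridiag m, f x =
        ∫⁻ p in {p | ((p.1 : EuclideanSpace ℝ (Fin (m + 1))), p.2) ∈ spectralDomain m},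
          f (inverseSpectralMap ((p.1 : EuclideanSpace ℝ (Fin (m + 1))), p.2)) *
            ENNReal.ofReal ((∏ k, (inverseSpectralMap
              ((p.1 : EuclideanSpace ℝ (Fin (m + 1))), p.2)).2 k) /
                ∏ i, (p.1 : EuclideanSpace ℝ (Fin (m + 1))) i)
          ∂(surfaceProd m)) := by
  refine ⟨fun x hx y => isSpectralData_iff hx y, bijOn_spectralMap, fun x hx => ?_, fun f hf => ?_⟩
  · have h := hasJacobianAt_inverseSpectralMap (bijOn_spectralMap.mapsTo hx)
    rwa [inverseSpectralMap_spectralMap hx] at h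
  · rw [lintegral_positiveTridiag_eq hf, lintegral_coneIntegrand_sphere]
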